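/- **Conventions.** A continuous function $f:\mathbb R\to\mathbb R$ is *$n$-th tropical meromorphic* if there are an increasing sequence $(x_i)_{i\in\mathbb Z}$ in $\mathbb R$ with $x_i\to\pm\infty$ as $i\to\pm\infty$, and polynomials $p_i$ with $f=p_i$ on $[x_i,x_{i+1}]$ and $\sup_i\deg p_i=n$. It is *well defined* if each piece $p_i$ has, apart from its constant term, only terms whose exponents have the parity of $\deg p_i$, with coefficients all $\ge 0$ or all $\le 0$ (constants are allowed). For $j\ge1$ put $$\omega_f^{(j)}(x)=\frac{\operatorname{sgn}^{j+1}(x^+)f^{(j)}(x^+)-\operatorname{sgn}^{j+1}(x^-)f^{(j)}(x^-)}{j!},\qquad \operatorname{sgn}(0^\pm)=\pm1 .$$ The point $x$ is a $j$-th root (pole) of $f$ of multiplicity $|\omega^{(j)}_f(x)|$ if $\omega_f^{(j)}(x)>0$ ($<0$). An $n$-th tropical meromorphic function is *$n$-th tropical entire* if it has no $j$-th poles for $1\le j\le n$. For an interval $I\subset[-r,r]$ let $$N_I^{(j)}(r,f)=\frac12\sum_{x\in I,\ \omega_f^{(j)}(x)<0}|\omega_f^{(j)}(x)|\,(r-|x|)^j,\qquad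 N^{(j)}(r,f)=N^{(j)}_{(-r,r)}(r,f),$$ and $1_0\oslash f=-f$, $f\oslash g=f-g$, $\overline f^{[k]}(x)=f(x+k)$. The tropical projective space $\mathbb{TP}^m$ is the set of vectors in $(\mathbb R\cup\{-\infty\})^{m+1}$ other than $(-\infty,\dots,-\infty)$, modulo adding a real constant to all coordinates. An *$n$-th tropical holomorphic curve* $f=[f_0:\cdots:f_m]:\mathbb R\to\mathbb{TP}^m$ is given by $n_i$-th tropical entire functions $f_i$ ($n_i\ge 0$) with $\max_i n_i=n$; the representation $(f_0,\dots,f_m)$ is *reduced* if for no $j\in\{1,\dots,n\}$ is there a point that is a $j$-th root of all the $f_i$. With $\Phi=\max_{0\le i\le m} f_i$ the Cartan characteristic is $T_f(r)=\frac12(\Phi(r)+\Phi(-r))-\Phi(0)$. The tropical Casoratian is $$C_0(f_0,\dots,f_m)(x)=\max_{\pi}\sum_{i=0}^m f_i(x+\pi(i)),$$ the maximum being over all permutations $\pi$ of $\{0,\dots,m\}$. **Theorem.** Let $n,m\ge1$ and let $f:\mathbb R\to\mathbb{TP}^m$ be an $n$-th tropical holomorphic curve with a reduced representation $(f_0,\dots,f_m)$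 as above. Suppose that there is $l\in\{0,\dots,m\}$ such that $f_i\oslash f_l$ is well defined for all $i=0,\dots,m$, that $$\limsup_{r\to\infty}\frac{\log\log T_f(r)}{\log r}=:\rho_2<1,$$ (with $\log\log$ read as $\log^+\log^+$, which matters only where $T_f(r)<e$), and let $\sigma\in(0,1-\rho_2)$. Then $$\begin{aligned}&\Bigl|\sum_{i=0}^m\sum_{j=1}^n N^{(j)}(r,1_0\oslash f_i)-\sum_{j=1}^nN^{(j)}\bigl(r,1_0\oslash C_0(f_0,\dots,f_m)\bigr)\Bigr|\\ &\quad\le\sum_{j=1}^n\Bigl|N^{(j)}\bigl(r,C_0(f_0,\dots,f_m)\bigr)-\sum_{i=0}^mN^{(j)}\bigl(r,\overline f_i^{[i]}\bigr)\Bigr|\\ &\qquad+\sum_{i=0}^m\sum_{j=1}^{\lfloor n/2\rfloor}\Bigl|N^{(2j)}_{[-2i,0]}\bigl(r,1_0\oslash\overline f_i^{[i]}\bigr)-N^{(2j)}_{[-i,i]}(r,1_0\oslash f_i)\Bigr|+o\Bigl(\frac{T_f(r)}{r^\sigma}\Bigr)\end{aligned}$$ as $r\to\infty$ outside a set $E$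 of finite logarithmic measure, i.e. $\int_{E\cap[1,\infty)}dr/r<\infty$. -/

import Mathlib

open Filter Topology Polynomial MeasureTheory Asymptotics

noncomputable section

namespace TropNevanlinna

/-! ### Piecewise polynomial functions -/

/-- `f` is the continuous piecewise polynomial function that equals the polynomial `p i` on
`[x i, x (i + 1)]`, where the increasing sequence `x` has no finite accumulation point
(and covers the real line; a function with finitely many pieces has such a description after
inserting artificial break points). -/
structure IsDecomposition (f : ℝ → ℝ) (x : ℤ → ℝ) (p : ℤ → ℝ[X]) : Prop where
  strictMono : StrictMono x
  tendsto_atTop : Tendsto x atTop atTop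
  tendsto_atBot : Tendsto x atBot atBot
  eq_eval : ∀ i, ∀ t ∈ Set.Icc (x i) (x (i + 1)), f t = (p i).eval t

/-- `n`-th tropical meromorphic function: the supremum of the degrees of the pieces is `n`. -/
def IsTropicalMeromorphic (n : ℕ) (f : ℝ → ℝ) : Prop :=
  ∃ (x : ℤ → ℝ) (p : ℤ → ℝ[X]), IsDecomposition f x p ∧
    IsLUB (Set.range fun i => (p i).natDegree) n

/-- A polynomial is well defined if, apart from its constant term, it only has terms whose exponent
has the parity of its degree, and the coefficients of these terms are all nonnegative or all
nonpositive. Constants are included. -/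
def PolyWellDefined (p : ℝ[X]) : Prop :=
  (∀ k, 1 ≤ k → p.coeff k ≠ 0 → k % 2 = p.natDegree % 2) ∧
    ((∀ k, 1 ≤ k → 0 ≤ p.coeff k) ∨ (∀ k, 1 ≤ k → p.coeff k ≤ 0))

/-- A piecewise polynomial function is well defined if each of its pieces is. -/
def IsWellDefined (f : ℝ → ℝ) : Prop :=
  ∃ (x : ℤ → ℝ) (p : ℤ → ℝ[X]), IsDecomposition f x p ∧ ∀ i, PolyWellDefined (p i)

/-! ### Roots and poles -/

/-- `sgn(x⁺)`, with `sgn(0⁺) = 1`. -/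
def sgnRight (x : ℝ) : ℝ := if 0 ≤ x then 1 else -1

/-- `sgn(x⁻)`, with `sgn(0⁻) = -1`. -/
def sgnLeft (x : ℝ) : ℝ := if 0 < x then 1 else -1

/-- `f^{(j)}(x⁺)`: the `j`-th derivative from the right. If `f` is a polynomial `p` on some
`[x, x + ε]`, this is `p^{(j)}(x)`. -/
def derivRight (j : ℕ) (f : ℝ → ℝ) (x : ℝ) : ℝ := iteratedDerivWithin j f (Set.Ici x) x

/-- `f^{(j)}(x⁻)`: the `j`-th derivative from the left. -/
def derivLeft (j : ℕ) (f : ℝ → ℝ) (x : ℝ) : ℝ := iteratedDerivWithin j f (Set.Iic x) x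

/-- `ω_f^{(j)}(x)`; the point `x` is a `j`-th root of `f` if this is positive and a `j`-th pole if
it is negative, with multiplicity its absolute value. -/
def omegaMult (f : ℝ → ℝ) (j : ℕ) (x : ℝ) : ℝ :=
  (sgnRight x ^ (j + 1) * derivRight j f x - sgnLeft x ^ (j + 1) * derivLeft j f x) / j.factorial

/-- `n`-th tropical entire function: an `n`-th tropical meromorphic function without poles. -/
def IsTropicalEntire (n : ℕ) (f : ℝ → ℝ) : Prop :=
  IsTropicalMeromorphic n f ∧ ∀ j, 1 ≤ j → j ≤ n → ∀ x, 0 ≤ omegaMult f j x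

/-- The partial `j`-th integrated counting function `N_I^{(j)}(r, f)` of the `j`-th poles of `f` in
`I`. For a piecewise polynomial `f` and a bounded `I` the sum is finite. The `j`-th roots of `f`
are the `j`-th poles of `-f` (tropical reciprocal), so they are counted by `countingOn I j r (-f)`. -/
def countingOn (I : Set ℝ) (j : ℕ) (r : ℝ) (f : ℝ → ℝ) : ℝ :=
  (1 / 2) * ∑ᶠ x ∈ {x : ℝ | x ∈ I ∧ omegaMult f j x < 0}, |omegaMult f j x| * (r - |x|) ^ j

/-- The `j`-th integrated counting function `N^{(j)}(r, f)` of the `j`-th poles of `f` in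
`(-r, r)`. -/
def counting (j : ℕ) (r : ℝ) (f : ℝ → ℝ) : ℝ := countingOn (Set.Ioo (-r) r) j r f

/-! ### Tropical projective space and holomorphic curves -/

/-- Vectors of the max-plus semiring, indexed by `0, …, m`, with not all coordinates `-∞`. -/
abbrev TropVec (m : ℕ) : Type := {a : Fin (m + 1) → WithBot ℝ // ∃ i, a i ≠ ⊥}

/-- `a ∼ b` if and only if `a = c ⊗ b` for some real `c`. -/
def tropSetoid (m : ℕ) : Setoid (TropVec m) where
  r a b := ∃ c : ℝ, ∀ i, a.1 i = (c : WithBot ℝ) + b.1 i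
  iseqv :=
    { refl := fun a => ⟨0, fun i => by simp⟩
      symm := by
        rintro a b ⟨c, hc⟩
        refine ⟨-c, fun i => ?_⟩
        rw [hc i, ← add_assoc, ← WithBot.coe_add]
        simp
      trans := by
        rintro a b d ⟨c, hc⟩ ⟨e, he⟩
        refine ⟨c + e, fun i => ?_⟩
        rw [hc i, he i, ← add_assoc, ← WithBot.coe_add] }

/-- The tropical projective space `TP^m`. -/
def TropProj (m : ℕ) : Type := Quotient (tropSetoid m)

/-- The point `[a 0 : ⋯ : a m]` with real homogeneous coordinates. -/
def TropProj.ofReal {m : ℕ} (a : Fin (m + 1) → ℝ) : TropProj m :=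
  Quotient.mk (tropSetoid m) ⟨fun i => (a i : WithBot ℝ), 0, WithBot.coe_ne_bot⟩

/-- `f = [F 0 : ⋯ : F m]` is an `n`-th tropical holomorphic curve: each `F i` is `d i`-th tropical
entire, and the maximum of the `d i` is `n`. -/
def IsHolomorphicCurve {m : ℕ} (n : ℕ) (f : ℝ → TropProj m) (F : Fin (m + 1) → ℝ → ℝ) : Prop :=
  (∃ d : Fin (m + 1) → ℕ, (∀ i, IsTropicalEntire (d i) (F i)) ∧ Finset.univ.sup d = n) ∧
    ∀ x, f x = TropProj.ofReal fun i => F i x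

/-- `F` is a reduced representation of the `n`-th tropical holomorphic curve `f`: no point is a
`j`-th root of all the `F i`. -/
def IsReducedRepresentation {m : ℕ} (n : ℕ) (f : ℝ → TropProj m) (F : Fin (m + 1) → ℝ → ℝ) :
    Prop :=
  IsHolomorphicCurve n f F ∧
    ∀ j, 1 ≤ j → j ≤ n → ∀ x, ¬ ∀ i, 0 < omegaMult (F i) j x

/-- The tropical sum `F(x) = max_i F_i(x)`. -/
def tropMax {m : ℕ} (F : Fin (m + 1) → ℝ → ℝ) (x : ℝ) : ℝ :=
  Finset.univ.sup' Finset.univ_nonempty fun i => F i x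

/-- The tropical Cartan characteristic function of the curve with reduced representation `F`. -/
def cartan {m : ℕ} (F : Fin (m + 1) → ℝ → ℝ) (r : ℝ) : ℝ :=
  (1 / 2) * (tropMax F r + tropMax F (-r)) - tropMax F 0

/-- The shift `x ↦ f(x + k)`. -/
def shift (k : ℕ) (f : ℝ → ℝ) (x : ℝ) : ℝ := f (x + k)

/-- The tropical Casoratian: the maximum over all permutations `π` of `{0, …, m}` of
`∑ i, F_i(x + π(i))`. -/
def casoratian {m : ℕ} (F : Fin (m + 1) → ℝ → ℝ) (x : ℝ) : ℝ :=
  Finset.univ.sup' Finset.univ_nonempty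
    fun π : Equiv.Perm (Fin (m + 1)) => ∑ i, shift (π i : ℕ) (F i) x

/-! ### Growth and exceptional sets -/

/-- The hyper-order `limsup (log log T(r)) / log r` as `r → ∞`, as an extended real number. The
iterated logarithm is `log⁺ log⁺`, which is `log log` wherever `T(r) ≥ e`. -/
def hyperOrder (T : ℝ → ℝ) : EReal :=
  limsup (fun r : ℝ => ((Real.posLog (Real.posLog (T r)) / Real.log r : ℝ) : EReal)) atTop

/-- A set of finite logarithmic measure: `∫_{E ∩ [1, ∞)} dr / r < ∞`. -/
def FiniteLogMeasure (E : Set ℝ) : Prop :=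
  MeasurableSet E ∧ ∫⁻ r in E ∩ Set.Ici 1, ENNReal.ofReal (1 / r) < ⊤

end TropNevanlinna

end

open TropNevanlinna

/-!
The theorem rests on an exact Jensen formula for continuous piecewise polynomials, on the fact that
tropical entire functions have only nonnegative multiplicities, and on a growth lemma for monotone
functions.

**Jensen formula.** Expanding `f` at the origin and collecting the jumps of its derivatives gives
Taylor's formula with truncated powers (`IsPiecewisePoly.taylor_right`); added to its mirror image it
becomes `∑_j (N^{(j)}(r, -f) - N^{(j)}(r, f)) = (f(r) + f(-r)) / 2 - f(0)`
(`IsPiecewisePoly.jensen`, `IsPiecewisePoly.sum_counting_neg`). Applied to the Casoratian `C₀` and to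
the translates `x ↦ F_i(x + i)`, it reduces the left-hand side of the theorem to three parts: the
difference of the counting functions of poles, which is the first sum on the right; the differences
`N^{(j)}(r, -F_i) - N^{(j)}(r, -F_i(· + i))`; and the values at `r`, `-r` and `0` of
`D = C₀ - ∑ i, F_i(· + i)`.

**Translates.** Translation by `i` preserves multiplicities of odd order, and those of even order
except at points carried across the origin; the latter make up the second sum on the right. The other
terms of the differences are sandwiched between the same nonnegative sums for `r - i` and `r + i`
(`IsPiecewisePoly.abs_countingOn_diff_sub_le`), so they are bounded by increments of the monotone
functions `signedCount (F i) k`.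

**The Casoratian.** Since `∑ i, F_0(x + π i)` does not depend on the permutation `π`, `D` is a maximum
of sums of increments of the quotients `F_i - F_0` (`casoratianDefect_le`). By Taylor's formula these
are bounded by increments of `signedCount` and of the Taylor polynomials of `F_i - F_0` at the origin
(`quotient_increment_le`).

**Smallness.** By Jensen, `signedCount (F i) k` is at most `2 T_f + O(1)`, so its increments are
`o(T_f(r) / r^σ)` outside a set of finite logarithmic measure (`exists_isLittleO_increment`). The
increment of `a r^k` is `O(r^{k-1})`, which is small because `T_f` grows at least like `r^k` as soon
as the quotients `F_i - F_0` have a Taylor coefficient of order `k`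
(`cartan_growth_of_coeff_ne`): either some coordinate has a root of order at least `k`, which by
itself forces this growth, or the terms of order at least `k` are odd functions and
`F_i(r) + F_l(-r)` grows like `r^k` for a suitable choice of `i` and `l`. If `T_f` does not even grow
linearly, then there are no roots and all quotients are constant, and the inequality holds without
any error term (`increments_eq_zero_of_degenerate`).
-/

noncomputable section

namespace TropNevanlinna

/-! ### Locally polynomial functions -/

/-- `f` is locally polynomial of degree at most `n`: at every point it has a polynomial germ from
the right and a polynomial germ from the left, both of degree at most `n` and both valid at the
point itself. This local form of piecewise polynomiality is stable under finite maxima without any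
merging of break points. -/
def IsPiecewisePoly (n : ℕ) (f : ℝ → ℝ) : Prop :=
  ∀ x, (∃ p : ℝ[X], p.natDegree ≤ n ∧ ∀ᶠ t in 𝓝[≥] x, f t = p.eval t) ∧
    ∃ q : ℝ[X], q.natDegree ≤ n ∧ ∀ᶠ t in 𝓝[≤] x, f t = q.eval t

lemma exists_break_right {x : ℤ → ℝ} (h1 : Tendsto x atTop atTop) (h2 : Tendsto x atBot atBot)
    (t : ℝ) : ∃ i, x i ≤ t ∧ t < x (i + 1) := by
  obtain ⟨a, ha⟩ := (h1.eventually_gt_atTop t).exists_forall_of_atTop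
  obtain ⟨b, hb⟩ := (h2.eventually_le_atBot t).exists
  obtain ⟨u, hu, hmax⟩ := Int.exists_greatest_of_bdd (P := fun i => x i ≤ t)
    ⟨a, fun z hz => by
      by_contra hc
      exact absurd (ha z (by omega)) (not_lt.2 hz)⟩ ⟨b, hb⟩
  refine ⟨u, hu, ?_⟩
  by_contra hc
  have := hmax (u + 1) (not_lt.1 hc)
  omega

lemma exists_break_left {x : ℤ → ℝ} (h1 : Tendsto x atTop atTop) (h2 : Tendsto x atBot atBot)
    (t : ℝ) : ∃ i, x i < t ∧ t ≤ x (i + 1) := by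
  obtain ⟨a, ha⟩ := (h1.eventually_gt_atTop t).exists_forall_of_atTop
  obtain ⟨b, hb⟩ := (h2.eventually_lt_atBot t).exists
  obtain ⟨u, hu, hmax⟩ := Int.exists_greatest_of_bdd (P := fun i => x i < t)
    ⟨a, fun z hz => by
      by_contra hc
      exact absurd (ha z (by omega)) (not_lt.2 hz.le)⟩ ⟨b, hb⟩
  refine ⟨u, hu, ?_⟩
  by_contra hc
  have := hmax (u + 1) (not_le.1 hc)
  omega

lemma IsDecomposition.isPiecewisePoly {f : ℝ → ℝ} {x : ℤ → ℝ} {p : ℤ → ℝ[X]} {n : ℕ}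
    (h : IsDecomposition f x p) (hd : ∀ i, (p i).natDegree ≤ n) : IsPiecewisePoly n f := by
  intro t
  constructor
  · obtain ⟨i, hi, hi'⟩ := exists_break_right h.tendsto_atTop h.tendsto_atBot t
    refine ⟨p i, hd i, ?_⟩
    filter_upwards [self_mem_nhdsWithin, mem_nhdsWithin_of_mem_nhds (Iio_mem_nhds hi')] with s hs hs'
    exact h.eq_eval i s ⟨hi.trans hs, le_of_lt hs'⟩
  · obtain ⟨i, hi, hi'⟩ := exists_break_left h.tendsto_atTop h.tendsto_atBot t
    refine ⟨p i, hd i, ?_⟩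
    filter_upwards [self_mem_nhdsWithin, mem_nhdsWithin_of_mem_nhds (Ioi_mem_nhds hi)] with s hs hs'
    exact h.eq_eval i s ⟨le_of_lt hs', le_trans hs hi'⟩

lemma tendsto_neg_nhdsGE (x : ℝ) : Tendsto (fun t : ℝ => -t) (𝓝[≥] (-x)) (𝓝[≤] x) := by
  refine tendsto_nhdsWithin_of_tendsto_nhds_of_eventually_within _ ?_ ?_
  · have : Tendsto (fun t : ℝ => -t) (𝓝 (-x)) (𝓝 (- -x)) := tendsto_id.neg
    rw [neg_neg] at this
    exact this.mono_left nhdsWithin_le_nhds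
  · filter_upwards [self_mem_nhdsWithin] with t ht
    simp only [Set.mem_Ici, Set.mem_Iic] at *
    linarith

lemma tendsto_neg_nhdsLE (x : ℝ) : Tendsto (fun t : ℝ => -t) (𝓝[≤] (-x)) (𝓝[≥] x) := by
  refine tendsto_nhdsWithin_of_tendsto_nhds_of_eventually_within _ ?_ ?_
  · have : Tendsto (fun t : ℝ => -t) (𝓝 (-x)) (𝓝 (- -x)) := tendsto_id.neg
    rw [neg_neg] at this
    exact this.mono_left nhdsWithin_le_nhds
  · filter_upwards [self_mem_nhdsWithin] with t ht
    simp only [Set.mem_Ici, Set.mem_Iic] at *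
    linarith

lemma natDegree_comp_neg_X_le {p : ℝ[X]} {n : ℕ} (hp : p.natDegree ≤ n) :
    (p.comp (-X)).natDegree ≤ n := by
  refine natDegree_comp_le.trans ?_
  simpa using hp

namespace IsPiecewisePoly

variable {n : ℕ} {f g : ℝ → ℝ}

lemma reflect (hf : IsPiecewisePoly n f) : IsPiecewisePoly n (fun t => f (-t)) := by
  intro x
  obtain ⟨⟨p, hp, hp'⟩, q, hq, hq'⟩ := hf (-x)
  have h1 := tendsto_neg_nhdsLE (-x)
  have h2 := tendsto_neg_nhdsGE (-x)
  rw [neg_neg] at h1 h2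
  refine ⟨⟨q.comp (-X), natDegree_comp_neg_X_le hq, ?_⟩, p.comp (-X),
    natDegree_comp_neg_X_le hp, ?_⟩
  · filter_upwards [h2.eventually hq'] with t ht
    simpa using ht
  · filter_upwards [h1.eventually hp'] with t ht
    simpa using ht

lemma add (hf : IsPiecewisePoly n f) (hg : IsPiecewisePoly n g) :
    IsPiecewisePoly n (fun t => f t + g t) := by
  intro x
  obtain ⟨⟨p, hp, hp'⟩, q, hq, hq'⟩ := hf x
  obtain ⟨⟨p₁, hp₁, hp₁'⟩, q₁, hq₁, hq₁'⟩ := hg x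
  refine ⟨⟨p + p₁, natDegree_add_le_of_degree_le hp hp₁, ?_⟩, q + q₁,
    natDegree_add_le_of_degree_le hq hq₁, ?_⟩
  · filter_upwards [hp', hp₁'] with t h1 h2
    rw [h1, h2, eval_add]
  · filter_upwards [hq', hq₁'] with t h1 h2
    rw [h1, h2, eval_add]

lemma neg (hf : IsPiecewisePoly n f) : IsPiecewisePoly n (fun t => -f t) := by
  intro x
  obtain ⟨⟨p, hp, hp'⟩, q, hq, hq'⟩ := hf x
  refine ⟨⟨-p, by simpa using hp, ?_⟩, -q, by simpa using hq, ?_⟩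
  · filter_upwards [hp'] with t h1
    rw [h1, eval_neg]
  · filter_upwards [hq'] with t h1
    rw [h1, eval_neg]

lemma zero : IsPiecewisePoly n (fun _ => 0) := fun _ =>
  ⟨⟨0, by simp, by simp⟩, 0, by simp, by simp⟩

lemma sum {ι : Type*} (s : Finset ι) {u : ι → ℝ → ℝ} (hu : ∀ i ∈ s, IsPiecewisePoly n (u i)) :
    IsPiecewisePoly n (fun t => ∑ i ∈ s, u i t) := by
  classical
  induction s using Finset.induction_on with
  | empty => simpa using zero
  | insert a s ha ih =>
    simp only [Finset.sum_insert ha]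
    exact (hu a (by simp)).add (ih fun i hi => hu i (by simp [hi]))

lemma shift (hf : IsPiecewisePoly n f) (k : ℕ) : IsPiecewisePoly n (shift k f) := by
  intro x
  obtain ⟨⟨p, hp, hp'⟩, q, hq, hq'⟩ := hf (x + k)
  have hc : Tendsto (fun t : ℝ => t + k) (𝓝 x) (𝓝 (x + k)) := tendsto_id.add_const _
  have hcomp : ∀ u : ℝ[X], u.natDegree ≤ n → (u.comp (X + C (k : ℝ))).natDegree ≤ n := fun u hu => by
    rw [← taylor_apply, natDegree_taylor]
    exact hu
  refine ⟨⟨p.comp (X + C (k : ℝ)), hcomp p hp, ?_⟩, q.comp (X + C (k : ℝ)), hcomp q hq, ?_⟩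
  · have := tendsto_nhdsWithin_of_tendsto_nhds_of_eventually_within (s := Set.Ici (x + (k : ℝ)))
      _ (hc.mono_left (nhdsWithin_le_nhds (s := Set.Ici x))) (by
        filter_upwards [self_mem_nhdsWithin] with t ht
        simpa using ht)
    filter_upwards [this.eventually hp'] with t ht
    simpa [TropNevanlinna.shift] using ht
  · have := tendsto_nhdsWithin_of_tendsto_nhds_of_eventually_within (s := Set.Iic (x + (k : ℝ)))
      _ (hc.mono_left (nhdsWithin_le_nhds (s := Set.Iic x))) (by
        filter_upwards [self_mem_nhdsWithin] with t ht
        simpa using ht)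
    filter_upwards [this.eventually hq'] with t ht
    simpa [TropNevanlinna.shift] using ht

end IsPiecewisePoly

/-- A polynomial has a constant sign on some right neighbourhood of any point. -/
lemma eventually_sign_right (p : ℝ[X]) (x : ℝ) :
    (∀ᶠ t in 𝓝[≥] x, 0 ≤ p.eval t) ∨ ∀ᶠ t in 𝓝[≥] x, p.eval t ≤ 0 := by
  by_cases hp : p = 0
  · simp [hp]
  obtain ⟨q, hq, hqx⟩ := exists_eq_pow_rootMultiplicity_mul_and_not_dvd p hp x
  rw [dvd_iff_isRoot, IsRoot] at hqx
  have hc : Tendsto (fun t => q.eval t) (𝓝[≥] x) (𝓝 (q.eval x)) :=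
    (q.continuous.tendsto x).mono_left nhdsWithin_le_nhds
  have hval : ∀ t, p.eval t = (t - x) ^ p.rootMultiplicity x * q.eval t := fun t => by
    conv_lhs => rw [hq]
    simp
  rcases lt_or_gt_of_ne hqx with h | h
  · right
    filter_upwards [self_mem_nhdsWithin, hc.eventually (gt_mem_nhds h)] with t ht ht'
    rw [hval]
    exact mul_nonpos_of_nonneg_of_nonpos (pow_nonneg (sub_nonneg.2 ht) _) ht'.le
  · left
    filter_upwards [self_mem_nhdsWithin, hc.eventually (lt_mem_nhds h)] with t ht ht'
    rw [hval]
    exact mul_nonneg (pow_nonneg (sub_nonneg.2 ht) _) ht'.le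

lemma eventually_sign_left (p : ℝ[X]) (x : ℝ) :
    (∀ᶠ t in 𝓝[≤] x, 0 ≤ p.eval t) ∨ ∀ᶠ t in 𝓝[≤] x, p.eval t ≤ 0 := by
  have h2 := tendsto_neg_nhdsLE (-x)
  rw [neg_neg] at h2
  rcases eventually_sign_right (p.comp (-X)) (-x) with h | h
  · left
    filter_upwards [h2.eventually h] with t ht
    simpa using ht
  · right
    filter_upwards [h2.eventually h] with t ht
    simpa using ht

/-- Of two polynomial germs one dominates the other, so the maximum is a polynomial germ. -/
lemma exists_germ_max {l : Filter ℝ} {n : ℕ} {f g : ℝ → ℝ} {p q : ℝ[X]}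
    (hp : p.natDegree ≤ n) (hq : q.natDegree ≤ n)
    (hf : ∀ᶠ t in l, f t = p.eval t) (hg : ∀ᶠ t in l, g t = q.eval t)
    (hs : (∀ᶠ t in l, 0 ≤ (p - q).eval t) ∨ ∀ᶠ t in l, (p - q).eval t ≤ 0) :
    ∃ u : ℝ[X], u.natDegree ≤ n ∧ ∀ᶠ t in l, f t ⊔ g t = u.eval t := by
  rcases hs with h | h
  · refine ⟨p, hp, ?_⟩
    filter_upwards [hf, hg, h] with t h1 h2 h3
    rw [eval_sub] at h3
    rw [h1, h2, sup_eq_left]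
    linarith
  · refine ⟨q, hq, ?_⟩
    filter_upwards [hf, hg, h] with t h1 h2 h3
    rw [eval_sub] at h3
    rw [h1, h2, sup_eq_right]
    linarith

namespace IsPiecewisePoly

variable {n : ℕ} {f g : ℝ → ℝ}

lemma sup (hf : IsPiecewisePoly n f) (hg : IsPiecewisePoly n g) :
    IsPiecewisePoly n (fun t => f t ⊔ g t) := by
  intro x
  obtain ⟨⟨p, hp, hp'⟩, q, hq, hq'⟩ := hf x
  obtain ⟨⟨p₁, hp₁, hp₁'⟩, q₁, hq₁, hq₁'⟩ := hg x
  exact ⟨exists_germ_max hp hp₁ hp' hp₁' (eventually_sign_right _ _),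
    exists_germ_max hq hq₁ hq' hq₁' (eventually_sign_left _ _)⟩

lemma sup' {ι : Type*} {s : Finset ι} (hs : s.Nonempty) {u : ι → ℝ → ℝ}
    (hu : ∀ i ∈ s, IsPiecewisePoly n (u i)) :
    IsPiecewisePoly n (fun t => s.sup' hs fun i => u i t) := by
  classical
  induction hs using Finset.Nonempty.cons_induction with
  | singleton a => simpa using hu a (by simp)
  | cons a s ha hs ih =>
    simp only [Finset.sup'_cons hs]
    exact (hu a (by simp)).sup (ih fun i hi => hu i (by simp [hi]))

lemma continuous (hf : IsPiecewisePoly n f) : Continuous f := by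
  rw [continuous_iff_continuousAt]
  intro x
  obtain ⟨⟨p, -, hp⟩, q, -, hq⟩ := hf x
  rw [continuousAt_iff_continuous_left_right]
  exact ⟨q.continuous.continuousWithinAt.congr_of_eventuallyEq hq
      (hq.self_of_nhdsWithin (Set.self_mem_Iic)),
    p.continuous.continuousWithinAt.congr_of_eventuallyEq hp
      (hp.self_of_nhdsWithin (Set.self_mem_Ici))⟩

end IsPiecewisePoly

/-! ### Multiplicities in terms of Taylor coefficients -/

lemma iteratedDeriv_polynomial_eval (p : ℝ[X]) (j : ℕ) :
    iteratedDeriv j (fun t => p.eval t) = fun t => (derivative^[j] p).eval t := by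
  induction j generalizing p with
  | zero => simp
  | succ j ih =>
    rw [iteratedDeriv_succ', Function.iterate_succ_apply, ← ih]
    congr 1
    ext t
    exact p.deriv

lemma iteratedDerivWithin_eq_taylor_coeff {f : ℝ → ℝ} {p : ℝ[X]} {s : Set ℝ} {x : ℝ} (j : ℕ)
    (hs : UniqueDiffOn ℝ s) (hx : x ∈ s) (h : ∀ᶠ t in 𝓝[s] x, f t = p.eval t) :
    iteratedDerivWithin j f s x = j.factorial * (taylor x p).coeff j := by
  rw [EventuallyEq.iteratedDerivWithin_eq (g := fun t => p.eval t) h (h.self_of_nhdsWithin hx),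
    iteratedDerivWithin_eq_iteratedDeriv hs (by simpa using (p.contDiff_aeval (𝕜 := ℝ) j).contDiffAt) hx,
    iteratedDeriv_polynomial_eval, taylor_coeff, ← factorial_smul_hasseDeriv]
  simp

/-- The `k`-th Taylor coefficient of `f` at `x` from the right. -/
def coeffRight (f : ℝ → ℝ) (k : ℕ) (x : ℝ) : ℝ := derivRight k f x / k.factorial

/-- The `k`-th Taylor coefficient of `f` at `x` from the left. -/
def coeffLeft (f : ℝ → ℝ) (k : ℕ) (x : ℝ) : ℝ := derivLeft k f x / k.factorial

lemma coeffRight_eq {f : ℝ → ℝ} {p : ℝ[X]} {x : ℝ} (k : ℕ)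
    (h : ∀ᶠ t in 𝓝[≥] x, f t = p.eval t) : coeffRight f k x = (taylor x p).coeff k := by
  rw [coeffRight, derivRight, iteratedDerivWithin_eq_taylor_coeff k (uniqueDiffOn_Ici x)
    Set.self_mem_Ici h]
  field_simp

lemma coeffLeft_eq {f : ℝ → ℝ} {p : ℝ[X]} {x : ℝ} (k : ℕ)
    (h : ∀ᶠ t in 𝓝[≤] x, f t = p.eval t) : coeffLeft f k x = (taylor x p).coeff k := by
  rw [coeffLeft, derivLeft, iteratedDerivWithin_eq_taylor_coeff k (uniqueDiffOn_Iic x)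
    Set.self_mem_Iic h]
  field_simp

lemma omegaMult_eq (f : ℝ → ℝ) (j : ℕ) (x : ℝ) :
    omegaMult f j x =
      sgnRight x ^ (j + 1) * coeffRight f j x - sgnLeft x ^ (j + 1) * coeffLeft f j x := by
  rw [omegaMult, coeffRight, coeffLeft]
  ring

lemma omegaMult_of_pos (f : ℝ → ℝ) (j : ℕ) {x : ℝ} (hx : 0 < x) :
    omegaMult f j x = coeffRight f j x - coeffLeft f j x := by
  simp [omegaMult_eq, sgnRight, sgnLeft, hx, hx.le]

lemma omegaMult_of_odd (f : ℝ → ℝ) {j : ℕ} (hj : Odd j) (x : ℝ) :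
    omegaMult f j x = coeffRight f j x - coeffLeft f j x := by
  have he : Even (j + 1) := hj.add_one
  have h1 : sgnRight x ^ (j + 1) = 1 := by
    unfold sgnRight; split_ifs <;> simp [he.neg_one_pow]
  have h2 : sgnLeft x ^ (j + 1) = 1 := by
    unfold sgnLeft; split_ifs <;> simp [he.neg_one_pow]
  rw [omegaMult_eq, h1, h2]
  ring

lemma omegaMult_neg (f : ℝ → ℝ) (j : ℕ) (x : ℝ) : omegaMult (-f) j x = -omegaMult f j x := by
  simp only [omegaMult, derivRight, derivLeft]
  rw [iteratedDerivWithin_neg, iteratedDerivWithin_neg]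
  ring

lemma taylor_comp_neg_X_coeff (p : ℝ[X]) (x : ℝ) (k : ℕ) :
    (taylor x (p.comp (-X))).coeff k = (-1) ^ k * (taylor (-x) p).coeff k := by
  have : taylor x (p.comp (-X)) = (taylor (-x) p).comp (C (-1) * X) := by
    simp only [taylor_apply, comp_assoc]
    congr 1
    simp
    ring
  rw [this, comp_C_mul_X_coeff, mul_comm]

namespace IsPiecewisePoly

variable {n : ℕ} {f : ℝ → ℝ}

lemma coeffRight_reflect (hf : IsPiecewisePoly n f) (k : ℕ) (x : ℝ) :
    coeffRight (fun t => f (-t)) k x = (-1) ^ k * coeffLeft f k (-x) := by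
  obtain ⟨-, q, -, hq⟩ := hf (-x)
  have h2 := tendsto_neg_nhdsGE (-x)
  rw [neg_neg] at h2
  rw [coeffLeft_eq k hq, coeffRight_eq (p := q.comp (-X)) k, taylor_comp_neg_X_coeff]
  filter_upwards [h2.eventually hq] with t ht
  simpa using ht

lemma coeffLeft_reflect (hf : IsPiecewisePoly n f) (k : ℕ) (x : ℝ) :
    coeffLeft (fun t => f (-t)) k x = (-1) ^ k * coeffRight f k (-x) := by
  obtain ⟨⟨q, -, hq⟩, -⟩ := hf (-x)
  have h2 := tendsto_neg_nhdsLE (-x)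
  rw [neg_neg] at h2
  rw [coeffRight_eq k hq, coeffLeft_eq (p := q.comp (-X)) k, taylor_comp_neg_X_coeff]
  filter_upwards [h2.eventually hq] with t ht
  simpa using ht

lemma _root_.TropNevanlinna.sgnRight_neg (x : ℝ) : sgnRight (-x) = -sgnLeft x := by
  unfold sgnRight sgnLeft
  by_cases h : 0 < x
  · rw [if_pos h, if_neg (by linarith)]
  · rw [if_neg h, if_pos (by linarith), neg_neg]

lemma _root_.TropNevanlinna.sgnLeft_neg (x : ℝ) : sgnLeft (-x) = -sgnRight x := by
  rw [← neg_neg (sgnLeft (-x)), ← sgnRight_neg, neg_neg]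

lemma omegaMult_reflect (hf : IsPiecewisePoly n f) (k : ℕ) (x : ℝ) :
    omegaMult (fun t => f (-t)) k x = omegaMult f k (-x) := by
  have hk : ((-1 : ℝ) ^ k) * (-1) ^ k = 1 := by rw [← mul_pow]; simp
  rw [omegaMult_eq, omegaMult_eq, hf.coeffRight_reflect, hf.coeffLeft_reflect, sgnRight_neg,
    sgnLeft_neg, neg_pow (sgnLeft x), neg_pow (sgnRight x)]
  ring

/-- At the origin, the multiplicity of order `k` is the sum of the `k`-th right Taylor coefficients
of `t ↦ f t` and of `t ↦ f (-t)`. -/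
lemma omegaMult_zero (hf : IsPiecewisePoly n f) (k : ℕ) :
    omegaMult f k 0 = coeffRight f k 0 + coeffRight (fun t => f (-t)) k 0 := by
  rw [omegaMult_eq, hf.coeffRight_reflect]
  simp only [sgnRight, sgnLeft, le_refl, lt_irrefl, if_true, if_false, neg_zero]
  ring

lemma coeffRight_shift (hf : IsPiecewisePoly n f) (a k : ℕ) (x : ℝ) :
    coeffRight (TropNevanlinna.shift a f) k x = coeffRight f k (x + a) := by
  obtain ⟨⟨p, -, hp⟩, -⟩ := hf (x + a)
  rw [coeffRight_eq k hp, coeffRight_eq (p := taylor (a : ℝ) p) k, taylor_taylor]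
  have hc : Tendsto (fun t : ℝ => t + a) (𝓝 x) (𝓝 (x + a)) := tendsto_id.add_const _
  have := tendsto_nhdsWithin_of_tendsto_nhds_of_eventually_within (s := Set.Ici (x + (a : ℝ)))
      _ (hc.mono_left (nhdsWithin_le_nhds (s := Set.Ici x))) (by
        filter_upwards [self_mem_nhdsWithin] with t ht
        simpa using ht)
  filter_upwards [this.eventually hp] with t ht
  simpa [TropNevanlinna.shift, taylor_apply] using ht

lemma coeffLeft_shift (hf : IsPiecewisePoly n f) (a k : ℕ) (x : ℝ) :
    coeffLeft (TropNevanlinna.shift a f) k x = coeffLeft f k (x + a) := by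
  obtain ⟨-, p, -, hp⟩ := hf (x + a)
  rw [coeffLeft_eq k hp, coeffLeft_eq (p := taylor (a : ℝ) p) k, taylor_taylor]
  have hc : Tendsto (fun t : ℝ => t + a) (𝓝 x) (𝓝 (x + a)) := tendsto_id.add_const _
  have := tendsto_nhdsWithin_of_tendsto_nhds_of_eventually_within (s := Set.Iic (x + (a : ℝ)))
      _ (hc.mono_left (nhdsWithin_le_nhds (s := Set.Iic x))) (by
        filter_upwards [self_mem_nhdsWithin] with t ht
        simpa using ht)
  filter_upwards [this.eventually hp] with t ht
  simpa [TropNevanlinna.shift, taylor_apply] using ht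

lemma omegaMult_shift_of_odd (hf : IsPiecewisePoly n f) (a : ℕ) {k : ℕ} (hk : Odd k) (x : ℝ) :
    omegaMult (TropNevanlinna.shift a f) k x = omegaMult f k (x + a) := by
  rw [omegaMult_of_odd _ hk, omegaMult_of_odd _ hk, hf.coeffRight_shift, hf.coeffLeft_shift]

/-- Translation by `a` changes a multiplicity only at points that it carries across the origin. -/
lemma omegaMult_shift_of_notMem (hf : IsPiecewisePoly n f) (a k : ℕ) {x : ℝ}
    (hx : x + a ∉ Set.Icc (-(a : ℝ)) a) :
    omegaMult (TropNevanlinna.shift a f) k x = omegaMult f k (x + a) := by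
  have ha : (0 : ℝ) ≤ a := a.cast_nonneg
  rw [omegaMult_eq, omegaMult_eq, hf.coeffRight_shift, hf.coeffLeft_shift]
  rw [Set.mem_Icc, not_and_or, not_le, not_le] at hx
  unfold sgnRight sgnLeft
  rcases hx with h | h
  · rw [if_neg (by linarith), if_neg (by linarith), if_neg (by linarith), if_neg (by linarith)]
  · rw [if_pos (by linarith), if_pos (by linarith), if_pos (by linarith), if_pos (by linarith)]

lemma coeffRight_of_lt (hf : IsPiecewisePoly n f) {k : ℕ} (hk : n < k) (x : ℝ) :
    coeffRight f k x = 0 := by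
  obtain ⟨⟨p, hp, hp'⟩, -⟩ := hf x
  rw [coeffRight_eq k hp']
  exact coeff_eq_zero_of_natDegree_lt (by rw [natDegree_taylor]; omega)

lemma coeffLeft_of_lt (hf : IsPiecewisePoly n f) {k : ℕ} (hk : n < k) (x : ℝ) :
    coeffLeft f k x = 0 := by
  obtain ⟨-, p, hp, hp'⟩ := hf x
  rw [coeffLeft_eq k hp']
  exact coeff_eq_zero_of_natDegree_lt (by rw [natDegree_taylor]; omega)

lemma omegaMult_of_lt (hf : IsPiecewisePoly n f) {k : ℕ} (hk : n < k) (x : ℝ) :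
    omegaMult f k x = 0 := by
  rw [omegaMult_eq, hf.coeffRight_of_lt hk, hf.coeffLeft_of_lt hk]
  ring

/-! ### Finitely many roots and poles on bounded sets -/

/-- Near `x` on either side `f` is a single polynomial, so roots and poles do not accumulate at `x`. -/
lemma eventually_omegaMult_eq_zero (hf : IsPiecewisePoly n f) (x : ℝ) :
    ∀ᶠ y in 𝓝[≠] x, ∀ j, omegaMult f j y = 0 := by
  have key : ∀ (p : ℝ[X]) (y : ℝ), y ≠ 0 → (∀ᶠ t in 𝓝 y, f t = p.eval t) →
      ∀ j, omegaMult f j y = 0 := by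
    intro p y hy hp j
    have hs : sgnRight y = sgnLeft y := by
      unfold sgnRight sgnLeft
      rcases lt_or_gt_of_ne hy with h | h
      · rw [if_neg (by linarith), if_neg (by linarith)]
      · rw [if_pos h.le, if_pos h]
    rw [omegaMult_eq, coeffRight_eq j (hp.filter_mono nhdsWithin_le_nhds),
      coeffLeft_eq j (hp.filter_mono nhdsWithin_le_nhds), hs]
    ring
  -- The origin is excluded because the signs in `omegaMult` differ there even without a jump.
  have hne : ∀ᶠ y in 𝓝[≠] x, y ≠ 0 := by
    by_cases hx : x = 0
    · rw [hx]; exact self_mem_nhdsWithin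
    · exact mem_nhdsWithin_of_mem_nhds (isOpen_ne.mem_nhds hx)
  rw [← nhdsLT_sup_nhdsGT] at hne ⊢
  rw [eventually_sup] at hne ⊢
  obtain ⟨⟨p, -, hp⟩, q, -, hq⟩ := hf x
  constructor
  · have := hq.filter_mono (nhdsWithin_mono x Set.Iio_subset_Iic_self)
    have h2 := eventually_eventually_nhdsWithin.2 this
    filter_upwards [hne.1, h2, self_mem_nhdsWithin] with y hy hy2 hyx
    rw [isOpen_Iio.nhdsWithin_eq hyx] at hy2
    exact key q y hy hy2
  · have := hp.filter_mono (nhdsWithin_mono x Set.Ioi_subset_Ici_self)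
    have h2 := eventually_eventually_nhdsWithin.2 this
    filter_upwards [hne.2, h2, self_mem_nhdsWithin] with y hy hy2 hyx
    rw [isOpen_Ioi.nhdsWithin_eq hyx] at hy2
    exact key p y hy hy2

lemma finite_omegaMult_ne_zero (hf : IsPiecewisePoly n f) (R : ℝ) :
    {y : ℝ | |y| ≤ R ∧ ∃ j, omegaMult f j y ≠ 0}.Finite := by
  by_contra hinf
  obtain ⟨x, -, hx⟩ := Set.Infinite.exists_accPt_of_subset_isCompact hinf
    (isCompact_Icc (a := -R) (b := R)) (fun y hy => abs_le.1 hy.1)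
  rw [accPt_iff_frequently_nhdsNE] at hx
  obtain ⟨y, hy, hy'⟩ := (hx.and_eventually (hf.eventually_omegaMult_eq_zero x)).exists
  obtain ⟨-, j, hj⟩ := hy
  exact hj (hy' j)

end IsPiecewisePoly

/-! ### Taylor expansion with jumps and the Jensen formula -/

/-- The contribution `∑_{y > 0} ω_f^{(k)}(y) (r - y)₊ᵏ` of the positive roots and poles of order `k`
to the value `f r`. -/
def rightCount (f : ℝ → ℝ) (k : ℕ) (r : ℝ) : ℝ :=
  ∑ᶠ y, if 0 < y then omegaMult f k y * max (r - y) 0 ^ k else 0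

/-- The signed counting function `∑_y ω_f^{(k)}(y) (r - |y|)₊ᵏ`; for `k ≥ 1` it is
`2 (N^{(k)}(r, -f) - N^{(k)}(r, f))`. -/
def signedCount (f : ℝ → ℝ) (k : ℕ) (r : ℝ) : ℝ :=
  ∑ᶠ y, omegaMult f k y * max (r - |y|) 0 ^ k

lemma polynomial_eq_of_eventually_left {p q : ℝ[X]} {f : ℝ → ℝ} {x : ℝ}
    (hp : ∀ᶠ t in 𝓝[≤] x, f t = p.eval t) (hq : ∀ᶠ t in 𝓝[≤] x, f t = q.eval t) : p = q := by
  apply taylor_injective x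
  ext k
  rw [← coeffLeft_eq k hp, ← coeffLeft_eq k hq]

lemma max_pow_eq_zero {t : ℝ} {k : ℕ} (hk : 1 ≤ k) (ht : t ≤ 0) : max t 0 ^ k = 0 := by
  rw [max_eq_right ht, zero_pow (by omega)]

/-- The polynomial `∑_{k=1}^n a_k (X - y)ᵏ` of the jumps of all orders at `y`. -/
def jumpPoly (n : ℕ) (a : ℕ → ℝ) (y : ℝ) : ℝ[X] := ∑ k ∈ Finset.Icc 1 n, C (a k) * (X - C y) ^ k

lemma eval_jumpPoly (n : ℕ) (a : ℕ → ℝ) (y t : ℝ) :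
    (jumpPoly n a y).eval t = ∑ k ∈ Finset.Icc 1 n, a k * (t - y) ^ k := by
  simp [jumpPoly, eval_finsetSum]

lemma taylor_jumpPoly_coeff (n : ℕ) (a : ℕ → ℝ) (y : ℝ) (j : ℕ) :
    (taylor y (jumpPoly n a y)).coeff j = if 1 ≤ j ∧ j ≤ n then a j else 0 := by
  have : taylor y (jumpPoly n a y) = ∑ k ∈ Finset.Icc 1 n, C (a k) * X ^ k := by
    rw [jumpPoly, map_sum]
    refine Finset.sum_congr rfl fun k _ => ?_
    simp [taylor_apply]
  rw [this, finsetSum_coeff]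
  simp [coeff_C_mul, coeff_X_pow]

/-- The germ from the left at `t` of a sum of truncated powers with vertex `y`; the vertex itself
counts as zero from the left and, in `eventually_truncated_right`, as a polynomial from the right. -/
lemma eventually_truncated_left {n : ℕ} (a : ℕ → ℝ) (y t : ℝ) :
    ∀ᶠ u in 𝓝[≤] t, ∑ k ∈ Finset.Icc 1 n, a k * max (u - y) 0 ^ k =
      (if y < t then jumpPoly n a y else 0).eval u := by
  split_ifs with h
  · filter_upwards [mem_nhdsWithin_of_mem_nhds (Ioi_mem_nhds h)] with u hu
    rw [eval_jumpPoly, max_eq_left (sub_nonneg.2 (le_of_lt hu))]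
  · filter_upwards [self_mem_nhdsWithin] with u hu
    rw [eval_zero]
    refine Finset.sum_eq_zero fun k hk => ?_
    rw [max_pow_eq_zero (Finset.mem_Icc.1 hk).1 (by linarith [Set.mem_Iic.1 hu]), mul_zero]

lemma eventually_truncated_right {n : ℕ} (a : ℕ → ℝ) (y t : ℝ) :
    ∀ᶠ u in 𝓝[≥] t, ∑ k ∈ Finset.Icc 1 n, a k * max (u - y) 0 ^ k =
      (if y ≤ t then jumpPoly n a y else 0).eval u := by
  split_ifs with h
  · filter_upwards [self_mem_nhdsWithin] with u hu
    rw [eval_jumpPoly, max_eq_left (sub_nonneg.2 (le_trans h hu))]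
  · filter_upwards [mem_nhdsWithin_of_mem_nhds (Iio_mem_nhds (not_le.1 h))] with u hu
    rw [eval_zero]
    refine Finset.sum_eq_zero fun k hk => ?_
    rw [max_pow_eq_zero (Finset.mem_Icc.1 hk).1 (by linarith [Set.mem_Iio.1 hu]), mul_zero]

namespace IsPiecewisePoly

variable {n : ℕ} {f : ℝ → ℝ}

lemma exists_finset_breaks (hf : IsPiecewisePoly n f) (R : ℝ) :
    ∃ Z : Finset ℝ, ∀ y, |y| ≤ R → ∀ k, omegaMult f k y ≠ 0 → y ∈ Z :=
  ⟨(hf.finite_omegaMult_ne_zero R).toFinset, fun y hy k hk => by simpa using ⟨hy, k, hk⟩⟩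

/-- The two germs at a positive point differ by the polynomial of the jumps there. -/
lemma germ_sub_germ (hf : IsPiecewisePoly n f) {t : ℝ} (ht : 0 < t) {p q : ℝ[X]}
    (hp : ∀ᶠ u in 𝓝[≥] t, f u = p.eval u) (hq : ∀ᶠ u in 𝓝[≤] t, f u = q.eval u) :
    p - q = jumpPoly n (fun k => omegaMult f k t) t := by
  apply taylor_injective t
  ext k
  rw [taylor_jumpPoly_coeff, map_sub, coeff_sub]
  by_cases h0 : k = 0
  · subst h0
    rw [if_neg (by omega), taylor_coeff_zero, taylor_coeff_zero,
      ← hp.self_of_nhdsWithin Set.self_mem_Ici, ← hq.self_of_nhdsWithin Set.self_mem_Iic, sub_self]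
  · rw [← coeffRight_eq k hp, ← coeffLeft_eq k hq, ← omegaMult_of_pos f k ht]
    split_ifs with h
    · rfl
    · exact hf.omegaMult_of_lt (by omega) t

/-- Subtracting the truncated powers that carry the jumps of `f` on `(0, r)` leaves a single
polynomial on `[0, r]`. -/
lemma exists_polynomial_eq (hf : IsPiecewisePoly n f) (r : ℝ) {Z : Finset ℝ}
    (hZ : ∀ y ∈ Z, 0 < y)
    (hZ' : ∀ y, 0 < y → y < r → ∀ k, omegaMult f k y ≠ 0 → y ∈ Z)
    {P : ℝ[X]} (hP : ∀ᶠ u in 𝓝[≥] (0 : ℝ), f u = P.eval u) :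
    ∀ u ∈ Set.Icc 0 r,
      f u - ∑ y ∈ Z, ∑ k ∈ Finset.Icc 1 n, omegaMult f k y * max (u - y) 0 ^ k = P.eval u := by
  set h : ℝ → ℝ := fun u =>
    f u - ∑ y ∈ Z, ∑ k ∈ Finset.Icc 1 n, omegaMult f k y * max (u - y) 0 ^ k with hh
  have hcont : Continuous h := by
    have := hf.continuous
    fun_prop
  have hZl : ∀ t, ∀ᶠ u in 𝓝[≤] t, ∑ y ∈ Z, ∑ k ∈ Finset.Icc 1 n,
      omegaMult f k y * max (u - y) 0 ^ k =
      (∑ y ∈ Z, if y < t then jumpPoly n (fun k => omegaMult f k y) y else 0).eval u := by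
    intro t
    have := (Finset.eventually_all Z).2 fun y _ =>
      eventually_truncated_left (n := n) (fun k => omegaMult f k y) y t
    filter_upwards [this] with u hu
    rw [eval_finsetSum]
    exact Finset.sum_congr rfl hu
  have hZr : ∀ t, ∀ᶠ u in 𝓝[≥] t, ∑ y ∈ Z, ∑ k ∈ Finset.Icc 1 n,
      omegaMult f k y * max (u - y) 0 ^ k =
      (∑ y ∈ Z, if y ≤ t then jumpPoly n (fun k => omegaMult f k y) y else 0).eval u := by
    intro t
    have := (Finset.eventually_all Z).2 fun y _ =>
      eventually_truncated_right (n := n) (fun k => omegaMult f k y) y t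
    filter_upwards [this] with u hu
    rw [eval_finsetSum]
    exact Finset.sum_congr rfl hu
  have h0 : ∀ᶠ u in 𝓝[≥] (0 : ℝ), h u = P.eval u := by
    filter_upwards [hP, hZr 0] with u h1 h2
    have : (∑ y ∈ Z, if y ≤ 0 then jumpPoly n (fun k => omegaMult f k y) y else 0) = 0 :=
      Finset.sum_eq_zero fun y hy => if_neg (not_le.2 (hZ y hy))
    rw [hh]
    simp only [h2, this, eval_zero, h1, sub_zero]
  -- From the left `h` has the germ `P` by assumption; the jump of `f` at `t` is the one subtracted.
  have hstep : ∀ t, 0 < t → t < r → (∀ u ∈ Set.Icc 0 t, h u = P.eval u) →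
      ∀ᶠ u in 𝓝[≥] t, h u = P.eval u := by
    intro t ht htr hu
    obtain ⟨⟨p, -, hp⟩, q, -, hq⟩ := hf t
    have hl : ∀ᶠ u in 𝓝[≤] t, h u = P.eval u := by
      filter_upwards [self_mem_nhdsWithin, mem_nhdsWithin_of_mem_nhds (Ioi_mem_nhds ht)]
        with u h1 h2 using hu u ⟨le_of_lt h2, h1⟩
    have hl' : ∀ᶠ u in 𝓝[≤] t, h u =
        (q - ∑ y ∈ Z, if y < t then jumpPoly n (fun k => omegaMult f k y) y else 0).eval u := by
      filter_upwards [hq, hZl t] with u h1 h2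
      rw [eval_sub, ← h1, ← h2]
    have e1 := polynomial_eq_of_eventually_left hl hl'
    have e2 := hf.germ_sub_germ ht hp hq
    have e3 : (∑ y ∈ Z, if y ≤ t then jumpPoly n (fun k => omegaMult f k y) y else 0) =
        (∑ y ∈ Z, if y < t then jumpPoly n (fun k => omegaMult f k y) y else 0) +
          jumpPoly n (fun k => omegaMult f k t) t := by
      have : ∀ y ∈ Z, (if y ≤ t then jumpPoly n (fun k => omegaMult f k y) y else 0) =
          (if y < t then jumpPoly n (fun k => omegaMult f k y) y else 0) +
            (if t = y then jumpPoly n (fun k => omegaMult f k y) y else 0) := by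
        intro y _
        rcases lt_trichotomy y t with hlt | heq | hgt
        · rw [if_pos hlt.le, if_pos hlt, if_neg hlt.ne', add_zero]
        · rw [if_pos heq.le, if_neg heq.not_lt, if_pos heq.symm, zero_add]
        · rw [if_neg hgt.not_ge, if_neg hgt.not_gt, if_neg hgt.ne, add_zero]
      rw [Finset.sum_congr rfl this, Finset.sum_add_distrib, Finset.sum_ite_eq]
      congr 1
      split_ifs with hmem
      · rfl
      · have hz : ∀ k, omegaMult f k t = 0 := fun k => by
          by_contra hne
          exact hmem (hZ' t ht htr k hne)
        simp [jumpPoly, hz]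
    filter_upwards [hp, hZr t] with u h1 h2
    have : h u =
      (p - ∑ y ∈ Z, if y ≤ t then jumpPoly n (fun k => omegaMult f k y) y else 0).eval u := by
      rw [eval_sub, ← h1, ← h2]
    rw [this, e3, e1, ← e2]
    congr 1
    ring
  -- Real induction: the set of `t` such that `h = P` on `[0, t]` is closed, and since the germs of
  -- `h` at `t` from the two sides coincide, it can be left to the right at no `t < r`.
  set s : Set ℝ := {t | ∀ u ∈ Set.Icc 0 t, h u = P.eval u} with hs
  rcases lt_or_ge r 0 with hr | hr
  · intro u hu
    exact absurd (hu.1.trans hu.2) (not_le.2 hr)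
  have hmain : Set.Icc 0 r ⊆ s := by
    refine IsClosed.Icc_subset_of_forall_exists_gt ?_ ?_ ?_
    · refine isClosed_of_closure_subset fun t ht => ?_
      have htI : t ∈ Set.Icc 0 r :=
        closure_minimal Set.inter_subset_right isClosed_Icc ht
      refine ⟨fun u hu => ?_, htI⟩
      rcases hu.2.lt_or_eq with hlt | heq
      · obtain ⟨t', ht', hut⟩ := mem_closure_iff.1 ht _ isOpen_Ioi (Set.mem_Ioi.2 hlt)
        exact hut.1 u ⟨hu.1, le_of_lt ht'⟩
      · have hcl : IsClosed {v | h v = P.eval v} := isClosed_eq hcont P.continuous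
        have := closure_minimal (s := s ∩ Set.Icc 0 r) (t := {v | h v = P.eval v})
          (fun v hv => hv.1 v ⟨hv.2.1, le_rfl⟩) hcl ht
        rw [heq]
        exact this
    · intro u hu
      have : u = 0 := le_antisymm hu.2 hu.1
      rw [this]
      exact h0.self_of_nhdsWithin Set.self_mem_Ici
    · rintro t ⟨hts, ht⟩ y hy
      have hev : ∀ᶠ u in 𝓝[≥] t, h u = P.eval u := by
        rcases ht.1.eq_or_lt with h1 | h1
        · rw [← h1]; exact h0
        · exact hstep t h1 ht.2 hts
      obtain ⟨v, hv, hv'⟩ := mem_nhdsGE_iff_exists_Icc_subset.1 hev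
      refine ⟨min v y, fun u hu => ?_, lt_min hv hy, min_le_right _ _⟩
      rcases le_total u t with hut | hut
      · exact hts u ⟨hu.1, hut⟩
      · exact hv' ⟨hut, hu.2.trans (min_le_left _ _)⟩
  exact fun u hu => hmain hu u ⟨hu.1, le_rfl⟩

lemma _root_.TropNevanlinna.rightCount_eq_sum {k : ℕ} (hk : 1 ≤ k) {r : ℝ} {Z : Finset ℝ}
    (hZ : ∀ y ∈ Z, 0 < y)
    (hZ' : ∀ y, 0 < y → y < r → ∀ k, omegaMult f k y ≠ 0 → y ∈ Z) :
    rightCount f k r = ∑ y ∈ Z, omegaMult f k y * max (r - y) 0 ^ k := by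
  rw [rightCount, finsum_eq_sum_of_support_subset (s := Z)]
  · exact Finset.sum_congr rfl fun y hy => if_pos (hZ y hy)
  · intro y hy
    rw [Function.mem_support] at hy
    split_ifs at hy with h0
    · refine hZ' y h0 ?_ k (left_ne_zero_of_mul hy)
      by_contra hc
      exact right_ne_zero_of_mul hy (max_pow_eq_zero hk (by linarith))
    · exact absurd rfl hy

/-- Taylor's formula for piecewise polynomials on the right half-line. -/
lemma taylor_right (hf : IsPiecewisePoly n f) {r : ℝ} (hr : 0 ≤ r) :
    f r = f 0 + ∑ k ∈ Finset.Icc 1 n, (coeffRight f k 0 * r ^ k + rightCount f k r) := by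
  obtain ⟨Z₀, hZ₀⟩ := hf.exists_finset_breaks r
  set Z := Z₀.filter (0 < ·) with hZdef
  have hZ : ∀ y ∈ Z, 0 < y := fun y hy => (Finset.mem_filter.1 hy).2
  have hZ' : ∀ y, 0 < y → y < r → ∀ k, omegaMult f k y ≠ 0 → y ∈ Z := fun y h1 h2 k hk =>
    Finset.mem_filter.2 ⟨hZ₀ y (by rw [abs_of_pos h1]; exact h2.le) k hk, h1⟩
  obtain ⟨⟨P, hPn, hP⟩, -⟩ := hf 0
  have hmain := hf.exists_polynomial_eq r hZ hZ' hP r ⟨hr, le_rfl⟩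
  have hPr : P.eval r = f 0 + ∑ k ∈ Finset.Icc 1 n, coeffRight f k 0 * r ^ k := by
    rw [eval_eq_sum_range' (Nat.lt_succ_of_le hPn), Finset.sum_range_succ', add_comm]
    congr 1
    · rw [hP.self_of_nhdsWithin Set.self_mem_Ici, pow_zero, mul_one, coeff_zero_eq_eval_zero]
    · refine Finset.sum_nbij (fun i => i + 1) (fun i hi => ?_) (fun a _ b _ h => by simpa using h)
        (fun k hk => ?_) fun k _ => ?_
      · simp only [Finset.mem_range, Finset.mem_Icc] at *
        omega
      · simp only [Finset.coe_Icc, Set.mem_Icc, Finset.coe_range, Set.mem_image, Set.mem_Iio] at *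
        exact ⟨k - 1, by omega, by omega⟩
      · rw [coeffRight_eq _ hP, taylor_zero]
  rw [Finset.sum_add_distrib, ← add_assoc, ← hPr, ← hmain, Finset.sum_comm,
    Finset.sum_congr rfl fun k hk =>
      rightCount_eq_sum (f := f) (Finset.mem_Icc.1 hk).1 hZ hZ']
  ring

lemma hasFiniteSupport_rightCount (hf : IsPiecewisePoly n f) {k : ℕ} (hk : 1 ≤ k) (r : ℝ) :
    (Function.support fun y => if 0 < y then omegaMult f k y * max (r - y) 0 ^ k else 0).Finite := by
  refine (hf.finite_omegaMult_ne_zero r).subset fun y hy => ?_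
  rw [Function.mem_support] at hy
  split_ifs at hy with h0
  · refine ⟨?_, k, left_ne_zero_of_mul hy⟩
    rw [abs_of_pos h0]
    by_contra hc
    exact right_ne_zero_of_mul hy (max_pow_eq_zero hk (by linarith))
  · exact absurd rfl hy

lemma hasFiniteSupport_signedCount (hf : IsPiecewisePoly n f) {k : ℕ} (hk : 1 ≤ k) (r : ℝ) :
    (Function.support fun y => omegaMult f k y * max (r - |y|) 0 ^ k).Finite := by
  refine (hf.finite_omegaMult_ne_zero r).subset fun y hy => ?_
  rw [Function.mem_support] at hy
  refine ⟨?_, k, left_ne_zero_of_mul hy⟩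
  by_contra hc
  exact right_ne_zero_of_mul hy (max_pow_eq_zero hk (by linarith))

lemma rightCount_reflect (hf : IsPiecewisePoly n f) (k : ℕ) (r : ℝ) :
    rightCount (fun t => f (-t)) k r =
      ∑ᶠ y, if y < 0 then omegaMult f k y * max (r + y) 0 ^ k else 0 := by
  rw [rightCount, ← finsum_comp_equiv (Equiv.neg ℝ)]
  refine finsum_congr fun y => ?_
  simp [hf.omegaMult_reflect]

lemma signedCount_reflect (hf : IsPiecewisePoly n f) (k : ℕ) (r : ℝ) :
    signedCount (fun t => f (-t)) k r = signedCount f k r := by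
  rw [signedCount, ← finsum_comp_equiv (Equiv.neg ℝ)]
  refine finsum_congr fun y => ?_
  simp [hf.omegaMult_reflect]

lemma signedCount_eq (hf : IsPiecewisePoly n f) {k : ℕ} (hk : 1 ≤ k) {r : ℝ} (hr : 0 ≤ r) :
    signedCount f k r = omegaMult f k 0 * r ^ k + rightCount f k r +
      rightCount (fun t => f (-t)) k r := by
  have h3 : (Function.support fun y : ℝ =>
      if y < 0 then omegaMult f k y * max (r + y) 0 ^ k else 0).Finite := by
    refine (hf.finite_omegaMult_ne_zero r).subset fun y hy => ?_
    rw [Function.mem_support] at hy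
    split_ifs at hy with h0
    · refine ⟨?_, k, left_ne_zero_of_mul hy⟩
      rw [abs_of_neg h0]
      by_contra hc
      exact right_ne_zero_of_mul hy (max_pow_eq_zero hk (by linarith))
    · exact absurd rfl hy
  have h1 : omegaMult f k 0 * r ^ k = ∑ᶠ y : ℝ, if y = 0 then omegaMult f k 0 * r ^ k else 0 := by
    rw [finsum_eq_single _ (0 : ℝ) fun y hy => if_neg hy, if_pos rfl]
  have h1' : (Function.support fun y : ℝ =>
      if y = 0 then omegaMult f k 0 * r ^ k else 0).Finite := by
    refine (Set.finite_singleton (0 : ℝ)).subset fun y hy => ?_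
    rw [Function.mem_support] at hy
    by_contra hc
    exact hy (if_neg hc)
  have h2 := hf.hasFiniteSupport_rightCount hk r
  rw [hf.rightCount_reflect, h1, rightCount, ← finsum_add_distrib h1' h2, ← finsum_add_distrib
    ((h1'.union h2).subset (Function.support_add _ _)) h3, signedCount]
  refine finsum_congr fun y => ?_
  rcases lt_trichotomy y 0 with h | h | h
  · rw [if_neg h.ne, if_neg h.not_gt, if_pos h, abs_of_neg h]
    ring_nf
  · subst h
    simp [hr]
  · rw [if_neg h.ne', if_pos h, if_neg h.not_gt, abs_of_pos h]
    ring

/-- The Jensen formula for piecewise polynomials. -/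
lemma jensen (hf : IsPiecewisePoly n f) {r : ℝ} (hr : 0 ≤ r) :
    f r + f (-r) - 2 * f 0 = ∑ k ∈ Finset.Icc 1 n, signedCount f k r := by
  have h1 := hf.taylor_right hr
  have h2 := hf.reflect.taylor_right hr
  rw [neg_zero] at h2
  have h3 : ∀ k ∈ Finset.Icc 1 n, signedCount f k r =
      (coeffRight f k 0 * r ^ k + rightCount f k r) +
        (coeffRight (fun t => f (-t)) k 0 * r ^ k + rightCount (fun t => f (-t)) k r) := by
    intro k hk
    rw [hf.signedCount_eq (Finset.mem_Icc.1 hk).1 hr, hf.omegaMult_zero k]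
    ring
  rw [h1, h2, Finset.sum_congr rfl h3, Finset.sum_add_distrib (f := fun k =>
    coeffRight f k 0 * r ^ k + rightCount f k r)]
  ring

/-! ### Counting functions as finite sums -/

lemma countingOn_neg_sub_countingOn (hf : IsPiecewisePoly n f) {I : Set ℝ} {R : ℝ}
    (hI : ∀ y ∈ I, |y| ≤ R) (k : ℕ) (r : ℝ) :
    countingOn I k r (-f) - countingOn I k r f =
      (1 / 2) * ∑ᶠ y, I.indicator (fun y => omegaMult f k y * (r - |y|) ^ k) y := by
  classical
  have hfin := hf.finite_omegaMult_ne_zero R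
  rw [countingOn, countingOn, ← mul_sub, finsum_mem_def, finsum_mem_def, ← finsum_sub_distrib]
  · congr 1
    refine finsum_congr fun y => ?_
    simp only [Set.indicator_apply, Set.mem_ofPred_eq, omegaMult_neg, abs_neg, neg_lt_zero]
    by_cases hy : y ∈ I
    · simp only [hy, true_and, if_true]
      rcases lt_trichotomy (omegaMult f k y) 0 with h | h | h
      · rw [if_neg h.not_gt, if_pos h, abs_of_neg h]; ring
      · simp [h]
      · rw [if_pos h, if_neg h.not_gt, abs_of_pos h]; ring
    · simp [hy]
  · refine hfin.subset fun y hy => ?_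
    have := Set.mem_of_indicator_ne_zero hy
    simp only [Set.mem_ofPred_eq, omegaMult_neg] at this
    exact ⟨hI y this.1, k, by linarith [this.2]⟩
  · refine hfin.subset fun y hy => ?_
    have := Set.mem_of_indicator_ne_zero hy
    exact ⟨hI y this.1, k, this.2.ne⟩

lemma counting_neg_sub_counting (hf : IsPiecewisePoly n f) {k : ℕ} (hk : 1 ≤ k) (r : ℝ) :
    counting k r (-f) - counting k r f = (1 / 2) * signedCount f k r := by
  rw [counting, counting, hf.countingOn_neg_sub_countingOn (I := Set.Ioo (-r) r) (R := r)
    (fun y hy => (abs_lt.2 hy).le), signedCount]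
  congr 1
  refine finsum_congr fun y => ?_
  by_cases hy : y ∈ Set.Ioo (-r) r
  · rw [Set.indicator_of_mem hy, max_eq_left]
    linarith [abs_lt.2 hy]
  · rw [Set.indicator_of_notMem hy, max_pow_eq_zero hk, mul_zero]
    by_contra hc
    exact hy (abs_lt.1 (by linarith))

end IsPiecewisePoly

/-! ### Functions without poles -/

lemma IsTropicalEntire.isPiecewisePoly {d n : ℕ} {f : ℝ → ℝ} (hf : IsTropicalEntire d f)
    (hd : d ≤ n) : IsPiecewisePoly n f := by
  obtain ⟨⟨x, p, hxp, hlub⟩, -⟩ := hf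
  exact hxp.isPiecewisePoly fun i => (hlub.1 ⟨i, rfl⟩).trans hd

lemma IsTropicalEntire.omegaMult_nonneg {d : ℕ} {f : ℝ → ℝ} (hf : IsTropicalEntire d f)
    {k : ℕ} (hk : 1 ≤ k) (y : ℝ) : 0 ≤ omegaMult f k y := by
  rcases le_or_gt k d with h | h
  · exact hf.2 k hk h y
  · rw [(hf.isPiecewisePoly le_rfl).omegaMult_of_lt h]

lemma countingOn_eq_zero {f : ℝ → ℝ} {I : Set ℝ} {k : ℕ} (hw : ∀ y ∈ I, 0 ≤ omegaMult f k y)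
    (r : ℝ) : countingOn I k r f = 0 := by
  have : {x : ℝ | x ∈ I ∧ omegaMult f k x < 0} = ∅ :=
    Set.eq_empty_of_forall_notMem fun y hy => absurd hy.2 (not_lt.2 (hw y hy.1))
  simp only [countingOn]
  rw [this]
  simp

/-- For `u` and `v` in `[a, b]` the truncated powers at `u` and `v` differ by at most the increment
over `[a, b]`. -/
lemma abs_max_pow_sub_le {a b u v : ℝ} (hau : a ≤ u) (hub : u ≤ b) (hav : a ≤ v) (hvb : v ≤ b)
    (k : ℕ) : |max v 0 ^ k - max u 0 ^ k| ≤ max b 0 ^ k - max a 0 ^ k := by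
  have hm : ∀ {x y : ℝ}, x ≤ y → max x 0 ^ k ≤ max y 0 ^ k := fun {x y} h =>
    pow_le_pow_left₀ (le_max_right _ _) (max_le_max_right 0 h) k
  rw [abs_le]
  constructor <;> linarith [hm hau, hm hub, hm hav, hm hvb]

namespace IsPiecewisePoly

variable {n : ℕ} {f : ℝ → ℝ}

lemma _root_.TropNevanlinna.signedCount_eq_sum {k : ℕ} (hk : 1 ≤ k) {r R : ℝ} (hr : r ≤ R) {Z : Finset ℝ}
    (hZ : ∀ y, |y| ≤ R → ∀ k, omegaMult f k y ≠ 0 → y ∈ Z) :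
    signedCount f k r = ∑ y ∈ Z, omegaMult f k y * max (r - |y|) 0 ^ k := by
  rw [signedCount, finsum_eq_sum_of_support_subset]
  intro y hy
  rw [Function.mem_support] at hy
  refine hZ y ?_ k (left_ne_zero_of_mul hy)
  by_contra hc
  exact right_ne_zero_of_mul hy (max_pow_eq_zero hk (by linarith))

lemma _root_.TropNevanlinna.rightCount_eq_sum_ite {k : ℕ} (hk : 1 ≤ k) {r R : ℝ} (hr : r ≤ R) {Z : Finset ℝ}
    (hZ : ∀ y, |y| ≤ R → ∀ k, omegaMult f k y ≠ 0 → y ∈ Z) :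
    rightCount f k r = ∑ y ∈ Z, if 0 < y then omegaMult f k y * max (r - y) 0 ^ k else 0 := by
  rw [rightCount, finsum_eq_sum_of_support_subset]
  intro y hy
  rw [Function.mem_support] at hy
  split_ifs at hy with h0
  · refine hZ y ?_ k (left_ne_zero_of_mul hy)
    rw [abs_of_pos h0]
    by_contra hc
    exact right_ne_zero_of_mul hy (max_pow_eq_zero hk (by linarith))
  · exact absurd rfl hy

lemma _root_.TropNevanlinna.signedCount_nonneg {k : ℕ} (hw : ∀ y, 0 ≤ omegaMult f k y) (r : ℝ) :
    0 ≤ signedCount f k r :=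
  finsum_nonneg fun y => mul_nonneg (hw y) (pow_nonneg (le_max_right _ _) _)

lemma _root_.TropNevanlinna.rightCount_nonneg {k : ℕ} (hw : ∀ y, 0 ≤ omegaMult f k y) (r : ℝ) :
    0 ≤ rightCount f k r := by
  refine finsum_nonneg fun y => ?_
  split_ifs
  · exact mul_nonneg (hw y) (pow_nonneg (le_max_right _ _) _)
  · exact le_rfl

lemma signedCount_mono (hf : IsPiecewisePoly n f) {k : ℕ} (hk : 1 ≤ k)
    (hw : ∀ y, 0 ≤ omegaMult f k y) : Monotone (signedCount f k) := by
  intro a b hab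
  obtain ⟨Z, hZ⟩ := hf.exists_finset_breaks b
  rw [signedCount_eq_sum hk hab hZ, signedCount_eq_sum hk le_rfl hZ]
  refine Finset.sum_le_sum fun y _ => mul_le_mul_of_nonneg_left ?_ (hw y)
  exact pow_le_pow_left₀ (le_max_right _ _) (max_le_max_right 0 (by linarith)) k

/-- A single root of order `k` makes the signed counting function grow like `rᵏ`. -/
lemma le_signedCount (hf : IsPiecewisePoly n f) {k : ℕ} (hk : 1 ≤ k)
    (hw : ∀ y, 0 ≤ omegaMult f k y) (y r : ℝ) :
    omegaMult f k y * max (r - |y|) 0 ^ k ≤ signedCount f k r :=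
  single_le_finsum y (hf.hasFiniteSupport_signedCount hk r)
    fun y => mul_nonneg (hw y) (pow_nonneg (le_max_right _ _) _)

lemma abs_rightCount_sub_le (hf : IsPiecewisePoly n f) {k : ℕ} (hk : 1 ≤ k)
    (hw : ∀ y, 0 ≤ omegaMult f k y) {a b u v : ℝ} (hau : a ≤ u) (hub : u ≤ b) (hav : a ≤ v)
    (hvb : v ≤ b) :
    |rightCount f k v - rightCount f k u| ≤ signedCount f k b - signedCount f k a := by
  obtain ⟨Z, hZ⟩ := hf.exists_finset_breaks b
  rw [signedCount_eq_sum hk (hau.trans hub) hZ, signedCount_eq_sum hk le_rfl hZ,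
    rightCount_eq_sum_ite hk hvb hZ, rightCount_eq_sum_ite hk hub hZ, ← Finset.sum_sub_distrib,
    ← Finset.sum_sub_distrib]
  refine (Finset.abs_sum_le_sum_abs _ _).trans (Finset.sum_le_sum fun y _ => ?_)
  split_ifs with h
  · rw [← mul_sub, ← mul_sub, abs_mul, abs_of_nonneg (hw y), abs_of_pos h]
    exact mul_le_mul_of_nonneg_left (abs_max_pow_sub_le (by linarith) (by linarith)
      (by linarith) (by linarith) k) (hw y)
  · have hm : max (a - |y|) 0 ^ k ≤ max (b - |y|) 0 ^ k :=
      pow_le_pow_left₀ (le_max_right _ _) (max_le_max_right 0 (by linarith)) k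
    rw [sub_zero, abs_zero, ← mul_sub]
    exact mul_nonneg (hw y) (by linarith)

/-! ### Counting functions of a translate -/

lemma countingOn_neg_of_nonneg (hf : IsPiecewisePoly n f) {I : Set ℝ} {k : ℕ}
    (hw : ∀ y ∈ I, 0 ≤ omegaMult f k y) {r : ℝ} (hI : I ⊆ Set.Ioo (-r) r) :
    countingOn I k r (-f) =
      (1 / 2) * ∑ᶠ y, I.indicator (fun y => omegaMult f k y * (r - |y|) ^ k) y := by
  rw [← hf.countingOn_neg_sub_countingOn (R := r) (fun y hy => (abs_lt.2 (hI hy)).le),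
    countingOn_eq_zero hw, sub_zero]

lemma countingOn_add_countingOn_diff (hf : IsPiecewisePoly n f) {A I : Set ℝ} {R : ℝ}
    (hI : ∀ y ∈ I, |y| ≤ R) (hA : A ⊆ I) (k : ℕ) (r : ℝ) :
    countingOn A k r f + countingOn (I \ A) k r f = countingOn I k r f := by
  have hfin := hf.finite_omegaMult_ne_zero R
  have hset : {y : ℝ | y ∈ I ∧ omegaMult f k y < 0} =
      {y : ℝ | y ∈ A ∧ omegaMult f k y < 0} ∪ {y : ℝ | y ∈ I \ A ∧ omegaMult f k y < 0} := by
    ext y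
    constructor
    · intro h
      by_cases hy : y ∈ A
      exacts [Or.inl ⟨hy, h.2⟩, Or.inr ⟨⟨h.1, hy⟩, h.2⟩]
    · rintro (h | h)
      exacts [⟨hA h.1, h.2⟩, ⟨h.1.1, h.2⟩]
  simp only [countingOn]
  rw [hset, ← mul_add, ← finsum_mem_union]
  · rw [Set.disjoint_left]
    exact fun y h1 h2 => h2.1.2 h1.1
  · exact hfin.subset fun y hy => ⟨hI y (hA hy.1), k, hy.2.ne⟩
  · exact hfin.subset fun y hy => ⟨hI y hy.1.1, k, hy.2.ne⟩

/-- Away from a set `B ⊆ [-a, a]` on which translation by `a` may change multiplicities, the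
counting functions of `f` and of its translate lie between the values of the signed counting
function at `r - a` and `r + a`, up to the terms in `B`. -/
lemma abs_countingOn_diff_sub_le (hf : IsPiecewisePoly n f) {k : ℕ} (hk : 1 ≤ k)
    (hw : ∀ y, 0 ≤ omegaMult f k y) (a : ℕ) (B : Set ℝ)
    (hB : ∀ y : ℝ, y + a ∉ B → omegaMult (TropNevanlinna.shift a f) k y = omegaMult f k (y + a))
    (r : ℝ) :
    |countingOn (Set.Ioo (-r) r \ B) k r (-f) -
        countingOn (Set.Ioo (-r) r \ (fun y : ℝ => y + a) ⁻¹' B) k r (-TropNevanlinna.shift a f)| ≤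
      (1 / 2) * (signedCount f k (r + a) - signedCount f k (r - a)) := by
  classical
  have ha : (0 : ℝ) ≤ a := a.cast_nonneg
  rw [hf.countingOn_neg_of_nonneg (fun y _ => hw y) Set.sdiff_subset,
    (hf.shift a).countingOn_neg_of_nonneg (fun y hy => by rw [hB y hy.2]; exact hw _)
      Set.sdiff_subset]
  have hmem : ∀ y : ℝ, y ∉ Set.Ioo (-r) r → max (r - |y|) 0 ^ k = 0 := fun y hy =>
    max_pow_eq_zero hk (by
      by_contra hc
      exact hy (abs_lt.1 (by linarith)))
  have e1 : ∀ y, (Set.Ioo (-r) r \ B).indicator (fun y => omegaMult f k y * (r - |y|) ^ k) y =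
      if y ∈ B then 0 else omegaMult f k y * max (r - |y|) 0 ^ k := by
    intro y
    by_cases h1 : y ∈ B
    · simp [h1]
    by_cases h2 : y ∈ Set.Ioo (-r) r
    · rw [Set.indicator_of_mem (show _ ∈ _ \ _ from ⟨h2, h1⟩), if_neg h1, max_eq_left]
      linarith [abs_lt.2 h2]
    · rw [Set.indicator_of_notMem (fun h => h2 h.1), if_neg h1, hmem y h2, mul_zero]
  set G : ℝ → ℝ := fun y => if y ∈ B then 0 else omegaMult f k y * max (r - |y - a|) 0 ^ k with hG
  have e2 : ∀ y : ℝ, (Set.Ioo (-r) r \ (fun y : ℝ => y + a) ⁻¹' B).indicator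
      (fun y => omegaMult (TropNevanlinna.shift a f) k y * (r - |y|) ^ k) y =
      G (y + a) := by
    intro y
    simp only [hG]
    rw [add_sub_cancel_right]
    by_cases h1 : y + a ∈ B
    · simp [h1]
    by_cases h2 : y ∈ Set.Ioo (-r) r
    · rw [Set.indicator_of_mem (show _ ∈ _ \ _ from ⟨h2, h1⟩), if_neg h1, max_eq_left, hB y h1]
      linarith [abs_lt.2 h2]
    · rw [Set.indicator_of_notMem (fun h => h2 h.1), if_neg h1, hmem y h2, mul_zero]
  have e3 : ∑ᶠ y : ℝ, G (y + a) = ∑ᶠ y, G y := finsum_comp_equiv (Equiv.addRight (a : ℝ))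
  rw [finsum_congr e1, finsum_congr e2, e3, hG]
  obtain ⟨Z, hZ⟩ := hf.exists_finset_breaks (r + a)
  have hab : ∀ y : ℝ, |y| ≤ |y - a| + a := fun y => by
    have := abs_sub_abs_le_abs_sub y a
    rw [abs_of_nonneg ha] at this
    linarith
  have hab' : ∀ y : ℝ, |y - a| ≤ |y| + a := fun y => by
    have := abs_sub y (a : ℝ)
    rwa [abs_of_nonneg ha] at this
  rw [signedCount_eq_sum hk le_rfl hZ,
    signedCount_eq_sum (r := r - a) (R := r + a) hk (by linarith) hZ,
    finsum_eq_sum_of_support_subset (s := Z), finsum_eq_sum_of_support_subset (s := Z),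
    ← mul_sub, abs_mul, abs_of_pos (by norm_num : (0 : ℝ) < 1 / 2), ← Finset.sum_sub_distrib,
    ← Finset.sum_sub_distrib]
  · refine mul_le_mul_of_nonneg_left ?_ (by norm_num)
    refine (Finset.abs_sum_le_sum_abs _ _).trans (Finset.sum_le_sum fun y _ => ?_)
    have hle := abs_max_pow_sub_le (a := r - a - |y|) (b := r + a - |y|) (u := r - |y - a|)
      (v := r - |y|) (by linarith [hab y, hab' y]) (by linarith [hab y, hab' y]) (by linarith)
      (by linarith) k
    split_ifs with h
    · rw [sub_self, abs_zero, ← mul_sub]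
      exact mul_nonneg (hw y) ((abs_nonneg _).trans hle)
    · rw [← mul_sub, ← mul_sub, abs_mul, abs_of_nonneg (hw y)]
      exact mul_le_mul_of_nonneg_left hle (hw y)
  · intro y hy
    rw [Function.mem_support] at hy
    split_ifs at hy with h0
    · exact absurd rfl hy
    · refine hZ y ?_ k (left_ne_zero_of_mul hy)
      by_contra hc
      exact right_ne_zero_of_mul hy (max_pow_eq_zero hk (by linarith [hab y]))
  · intro y hy
    rw [Function.mem_support] at hy
    split_ifs at hy with h0
    · exact absurd rfl hy
    · refine hZ y ?_ k (left_ne_zero_of_mul hy)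
      by_contra hc
      exact right_ne_zero_of_mul hy (max_pow_eq_zero hk (by linarith))

lemma abs_counting_sub_counting_shift_of_odd (hf : IsPiecewisePoly n f) {k : ℕ} (hk : Odd k)
    (hw : ∀ y, 0 ≤ omegaMult f k y) (a : ℕ) (r : ℝ) :
    |counting k r (-f) - counting k r (-TropNevanlinna.shift a f)| ≤
      (1 / 2) * (signedCount f k (r + a) - signedCount f k (r - a)) := by
  simpa [counting] using hf.abs_countingOn_diff_sub_le hk.pos hw a ∅
    (fun y _ => hf.omegaMult_shift_of_odd a hk y) r

lemma abs_counting_sub_counting_shift (hf : IsPiecewisePoly n f) {k : ℕ} (hk : 1 ≤ k)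
    (hw : ∀ y, 0 ≤ omegaMult f k y) (a : ℕ) {r : ℝ} (hr : 2 * (a : ℝ) < r) :
    |counting k r (-f) - counting k r (-TropNevanlinna.shift a f)| ≤
      |countingOn (Set.Icc (-2 * (a : ℝ)) 0) k r (-TropNevanlinna.shift a f) -
        countingOn (Set.Icc (-(a : ℝ)) a) k r (-f)| +
      (1 / 2) * (signedCount f k (r + a) - signedCount f k (r - a)) := by
  have ha : (0 : ℝ) ≤ a := a.cast_nonneg
  have hpre : (fun y : ℝ => y + a) ⁻¹' Set.Icc (-(a : ℝ)) a = Set.Icc (-2 * (a : ℝ)) 0 := by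
    ext y
    simp only [Set.mem_preimage, Set.mem_Icc]
    constructor <;> rintro ⟨h1, h2⟩ <;> constructor <;> linarith
  have h := hf.abs_countingOn_diff_sub_le hk hw a (Set.Icc (-(a : ℝ)) a)
    (fun y hy => hf.omegaMult_shift_of_notMem a k hy) r
  rw [hpre] at h
  have h1 := hf.neg.countingOn_add_countingOn_diff (A := Set.Icc (-(a : ℝ)) a)
    (I := Set.Ioo (-r) r) (R := r) (fun y hy => (abs_lt.2 hy).le)
    (fun y hy => ⟨by linarith [hy.1], by linarith [hy.2]⟩) k r
  have h2 := (hf.shift a).neg.countingOn_add_countingOn_diff (A := Set.Icc (-2 * (a : ℝ)) 0)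
    (I := Set.Ioo (-r) r) (R := r) (fun y hy => (abs_lt.2 hy).le)
    (fun y hy => ⟨by linarith [hy.1], by linarith [hy.2]⟩) k r
  have e1 : (fun t => -f t) = -f := rfl
  have e2 : (fun t => -TropNevanlinna.shift a f t) = -TropNevanlinna.shift a f := rfl
  rw [e1] at h1
  rw [e2] at h2
  rw [counting, counting, ← h1, ← h2]
  rw [abs_le] at h ⊢
  have := abs_le.1 (le_refl |countingOn (Set.Icc (-2 * (a : ℝ)) 0) k r
    (-TropNevanlinna.shift a f) - countingOn (Set.Icc (-(a : ℝ)) a) k r (-f)|)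
  constructor <;> linarith [h.1, h.2, this.1, this.2]

end IsPiecewisePoly

/-! ### Growth of increments outside a set of finite logarithmic measure -/

/-- Comparison of `b^{-(q+1)} (b - a)` with the integral of `t^{-(q+1)}` over `[a, b]`. -/
lemma rpow_neg_mul_sub_le {a b q : ℝ} (ha : 0 < a) (hab : a ≤ b) (hq : 0 < q) :
    b ^ (-(q + 1)) * (b - a) ≤ (a ^ (-q) - b ^ (-q)) / q := by
  have hb : 0 < b := ha.trans_le hab
  set t := a / b with ht
  have ht0 : 0 < t := div_pos ha hb
  have h1 : 1 + q * (1 - t) ≤ t ^ (-q) := by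
    rw [Real.rpow_def_of_pos ht0]
    have h2 := Real.add_one_le_exp (Real.log t * -q)
    have h3 := Real.log_le_sub_one_of_pos ht0
    nlinarith
  have h4 : a ^ (-q) = b ^ (-q) * t ^ (-q) := by
    rw [← Real.mul_rpow hb.le ht0.le, ht, mul_div_cancel₀ _ hb.ne']
  have h5 : b ^ (-(q + 1)) * (b - a) = b ^ (-q) * (1 - t) := by
    rw [neg_add, Real.rpow_add hb, Real.rpow_neg_one, ht]
    field_simp
  have hbq : 0 < b ^ (-q) := Real.rpow_pos_of_pos hb _
  rw [h5, h4, le_div_iff₀ hq]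
  nlinarith

lemma summable_sub_add_three {u : ℕ → ℝ} (hu : Antitone u) (h0 : ∀ k, 0 ≤ u k) :
    Summable fun k => u k - u (k + 3) := by
  refine summable_of_sum_range_le (c := u 0 + u 1 + u 2)
    (fun k => sub_nonneg.2 (hu (by omega))) fun N => ?_
  have : ∑ k ∈ Finset.range N, (u k - u (k + 3)) =
      u 0 + u 1 + u 2 - (u N + u (N + 1) + u (N + 2)) := by
    induction N with
    | zero => simp
    | succ N ih => rw [Finset.sum_range_succ, ih]; ring
  rw [this]
  linarith [h0 N, h0 (N + 1), h0 (N + 2)]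

/-- A monotone sequence bounded by `C (k + 1)^ρ` has increments at least `(k + 1)^{-s} / 2`, where
`s + ρ < 1`, only on a set of indices with finite harmonic sum. -/
lemma summable_indicator_of_increment {L : ℕ → ℝ} (hL : Monotone L) (hL1 : ∀ k, 1 ≤ L k)
    {C ρ s : ℝ} (hC : 0 < C) (hρ : 0 < ρ) (hs : s + ρ < 1)
    (hLC : ∀ᶠ k : ℕ in atTop, L k ≤ C * ((k : ℝ) + 1) ^ ρ) :
    Summable (Set.indicator {k : ℕ | ((k : ℝ) + 1) ^ (-s) / 2 ≤ L (k + 3) - L k}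
      fun k => 1 / ((k : ℝ) + 1)) := by
  -- At the indices in question `1 / (k + 1)` is at most a constant times `L ^ (-p) * ΔL` with `p > 1`,
  -- and this is dominated by a telescoping sum.
  set p : ℝ := (1 - s) / ρ with hp
  have hp1 : 1 < p := by rw [hp, lt_div_iff₀ hρ]; linarith
  set q : ℝ := p - 1 with hq
  have hq0 : 0 < q := by linarith
  have hL0 : ∀ k, 0 < L k := fun k => zero_lt_one.trans_le (hL1 k)
  have hu : Antitone fun k => L k ^ (-q) := fun i j hij =>
    Real.rpow_le_rpow_of_nonpos (hL0 i) (hL hij) (by linarith)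
  have hsum := summable_sub_add_three hu fun k => (Real.rpow_pos_of_pos (hL0 k) _).le
  set D : ℝ := C * 4 ^ ρ with hD
  have hD0 : 0 < D := by positivity
  refine Summable.of_norm_bounded_eventually_nat (hsum.mul_left (2 * D ^ p / q)) ?_
  filter_upwards [(tendsto_add_atTop_nat 3).eventually hLC] with k hk
  have hmono : L (k + 3) ^ (-q) ≤ L k ^ (-q) := hu (by omega)
  have hk0 : (0 : ℝ) < (k : ℝ) + 1 := by positivity
  by_cases hmem : k ∈ {k : ℕ | ((k : ℝ) + 1) ^ (-s) / 2 ≤ L (k + 3) - L k}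
  · rw [Set.indicator_of_mem hmem, Real.norm_of_nonneg (by positivity)]
    rw [Set.mem_ofPred_eq] at hmem
    have h1 : 1 / ((k : ℝ) + 1) = ((k : ℝ) + 1) ^ (-(1 - s)) * ((k : ℝ) + 1) ^ (-s) := by
      rw [← Real.rpow_add hk0, show -(1 - s) + -s = (-1 : ℝ) by ring, Real.rpow_neg_one, one_div]
    have h2 : L (k + 3) ≤ D * ((k : ℝ) + 1) ^ ρ := by
      refine hk.trans ?_
      rw [hD, mul_assoc, ← Real.mul_rpow (by norm_num) hk0.le]
      refine mul_le_mul_of_nonneg_left (Real.rpow_le_rpow (by positivity) ?_ hρ.le) hC.le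
      push_cast
      linarith [k.cast_nonneg (α := ℝ)]
    have h3 : ((k : ℝ) + 1) ^ (-(1 - s)) ≤ D ^ p * L (k + 3) ^ (-p) := by
      have hkρ : 0 < ((k : ℝ) + 1) ^ ρ := Real.rpow_pos_of_pos hk0 _
      have e : ((k : ℝ) + 1) ^ (-(1 - s)) = (((k : ℝ) + 1) ^ ρ) ^ (-p) := by
        rw [← Real.rpow_mul hk0.le, hp]
        congr 1
        field_simp
      have h4 := Real.rpow_le_rpow_of_nonpos (hL0 (k + 3)) h2 (by linarith : -p ≤ 0)
      rw [Real.mul_rpow hD0.le hkρ.le] at h4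
      rw [e]
      have h5 : D ^ p * D ^ (-p) = 1 := by
        rw [← Real.rpow_add hD0, add_neg_cancel, Real.rpow_zero]
      calc (((k : ℝ) + 1) ^ ρ) ^ (-p) = D ^ p * (D ^ (-p) * (((k : ℝ) + 1) ^ ρ) ^ (-p)) := by
            rw [← mul_assoc, h5, one_mul]
        _ ≤ _ := mul_le_mul_of_nonneg_left h4 (by positivity)
    have h6 := rpow_neg_mul_sub_le (hL0 k) (hL (by omega : k ≤ k + 3)) hq0
    rw [show q + 1 = p by ring] at h6
    have hL3 : 0 < L (k + 3) ^ (-p) := Real.rpow_pos_of_pos (hL0 _) _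
    have hDp : 0 < D ^ p := Real.rpow_pos_of_pos hD0 _
    calc 1 / ((k : ℝ) + 1) = ((k : ℝ) + 1) ^ (-(1 - s)) * ((k : ℝ) + 1) ^ (-s) := h1
      _ ≤ (D ^ p * L (k + 3) ^ (-p)) * (2 * (L (k + 3) - L k)) := by
          refine mul_le_mul h3 (by linarith) (by positivity) (by positivity)
      _ = 2 * D ^ p * (L (k + 3) ^ (-p) * (L (k + 3) - L k)) := by ring
      _ ≤ 2 * D ^ p * ((L k ^ (-q) - L (k + 3) ^ (-q)) / q) :=
          mul_le_mul_of_nonneg_left h6 (by positivity)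
      _ = 2 * D ^ p / q * (L k ^ (-q) - L (k + 3) ^ (-q)) := by ring
  · rw [Set.indicator_of_notMem hmem, norm_zero]
    exact mul_nonneg (by positivity) (by linarith)

lemma finiteLogMeasure_iUnion {s : ℕ} (hs : 1 ≤ s) {B : Set ℕ}
    (hB : Summable (B.indicator fun k : ℕ => 1 / ((k : ℝ) + 1))) :
    FiniteLogMeasure (⋃ k ∈ B, Set.Ico ((s : ℝ) * ((k : ℝ) + 1)) (s * ((k : ℝ) + 2))) := by
  have hs0 : (0 : ℝ) < s := by exact_mod_cast hs
  refine ⟨MeasurableSet.biUnion B.to_countable fun k _ => measurableSet_Ico, ?_⟩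
  have hnn : ∀ k, 0 ≤ B.indicator (fun k : ℕ => 1 / ((k : ℝ) + 1)) k :=
    fun k => Set.indicator_nonneg (fun _ _ => by positivity) k
  refine lt_of_le_of_lt (lintegral_mono_set Set.inter_subset_left) ?_
  refine lt_of_le_of_lt (lintegral_iUnion_le _ _) ?_
  refine lt_of_le_of_lt (b := ∑' k, ENNReal.ofReal (B.indicator (fun k : ℕ => 1 / ((k : ℝ) + 1)) k))
    (ENNReal.tsum_le_tsum fun k => ?_) ?_
  · by_cases hk : k ∈ B
    · have : (⋃ (_ : k ∈ B), Set.Ico ((s : ℝ) * ((k : ℝ) + 1)) (s * ((k : ℝ) + 2))) =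
          Set.Ico ((s : ℝ) * ((k : ℝ) + 1)) (s * ((k : ℝ) + 2)) := by simp [hk]
      rw [this, Set.indicator_of_mem hk]
      calc ∫⁻ r in Set.Ico ((s : ℝ) * ((k : ℝ) + 1)) (s * ((k : ℝ) + 2)), ENNReal.ofReal (1 / r)
          ≤ ∫⁻ _ in Set.Ico ((s : ℝ) * ((k : ℝ) + 1)) (s * ((k : ℝ) + 2)),
              ENNReal.ofReal (1 / ((s : ℝ) * ((k : ℝ) + 1))) := by
            refine setLIntegral_mono measurable_const fun r hr => ENNReal.ofReal_le_ofReal ?_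
            exact one_div_le_one_div_of_le (by positivity) hr.1
        _ = ENNReal.ofReal (1 / ((k : ℝ) + 1)) := by
            rw [setLIntegral_const, Real.volume_Ico, ← ENNReal.ofReal_mul (by positivity)]
            congr 1
            field_simp
            ring
    · simp [hk]
  · rw [← ENNReal.ofReal_tsum_of_nonneg hnn hB]
    exact ENNReal.ofReal_lt_top

/-- A monotone function `H` with `log H(r) ≤ C r^ρ` has increments over intervals of a fixed length
that are `o(H(r) / r^σ)` outside a set of finite logarithmic measure, if `σ + ρ < 1`. -/
theorem exists_isLittleO_increment {H : ℝ → ℝ} (hH : Monotone H) (hHe : ∀ r, Real.exp 1 ≤ H r)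
    {C ρ σ : ℝ} (hC : 0 < C) (hρ : 0 < ρ) (hσ : 0 < σ) (hσρ : σ + ρ < 1)
    (hHC : ∀ᶠ r in atTop, Real.log (H r) ≤ C * r ^ ρ) {s : ℕ} (hs : 1 ≤ s) :
    ∃ E : Set ℝ, FiniteLogMeasure E ∧
      (fun r => H (r + s) - H (r - s)) =o[atTop ⊓ 𝓟 Eᶜ] fun r => H r / r ^ σ := by
  have hs0 : (0 : ℝ) < s := by exact_mod_cast hs
  have hH0 : ∀ r, 0 < H r := fun r => (Real.exp_pos 1).trans_le (hHe r)
  -- The slack between `σ` and `τ` turns a bound of order `r ^ (-τ)` into `o(r ^ (-σ))`.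
  obtain ⟨τ, hτ1, hτ2⟩ := exists_between (show σ < 1 - ρ by linarith)
  have hτ0 : 0 < τ := hσ.trans hτ1
  -- On a grid of mesh `s`, an interval `[s (k + 1), s (k + 2))` is exceptional if `log H` increases by
  -- more than `(k + 1) ^ (-τ) / 2` from `s k` to `s (k + 3)`, which covers `r - s` and `r + s`.
  set L : ℕ → ℝ := fun k => Real.log (H (s * k)) with hLdef
  have hL : Monotone L := fun i j hij =>
    Real.log_le_log (hH0 _) (hH (by gcongr))
  have hL1 : ∀ k, 1 ≤ L k := fun k => by
    rw [hLdef]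
    exact (Real.le_log_iff_exp_le (hH0 _)).2 (hHe _)
  have hLC : ∀ᶠ k : ℕ in atTop, L k ≤ (C * (s : ℝ) ^ ρ) * ((k : ℝ) + 1) ^ ρ := by
    have ht : Tendsto (fun k : ℕ => (s : ℝ) * k) atTop atTop :=
      tendsto_natCast_atTop_atTop.const_mul_atTop hs0
    filter_upwards [ht.eventually hHC] with k hk
    refine hk.trans ?_
    rw [mul_assoc, ← Real.mul_rpow hs0.le (by positivity)]
    gcongr
    linarith
  have hsum := summable_indicator_of_increment hL hL1 (by positivity) hρ
    (show τ + ρ < 1 by linarith) hLC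
  refine ⟨_, finiteLogMeasure_iUnion hs hsum, ?_⟩
  rw [isLittleO_iff]
  intro c hc
  have hlim : Tendsto (fun r : ℝ => (2 * (s : ℝ)) ^ τ * r ^ (-(τ - σ))) atTop (𝓝 0) := by
    simpa using (tendsto_rpow_neg_atTop (sub_pos.2 hτ1)).const_mul ((2 * (s : ℝ)) ^ τ)
  rw [eventually_inf_principal]
  filter_upwards [hlim.eventually (ge_mem_nhds hc), eventually_ge_atTop (s : ℝ)] with r hr hrs hrE
  have hr0 : 0 < r := hs0.trans_le hrs
  have hfl : 1 ≤ ⌊r / s⌋₊ := by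
    rw [Nat.one_le_floor_iff, le_div_iff₀ hs0, one_mul]
    exact hrs
  obtain ⟨k, hk⟩ := Nat.exists_eq_add_of_le' hfl
  have hk1 : (s : ℝ) * ((k : ℝ) + 1) ≤ r := by
    have := Nat.floor_le (div_nonneg hr0.le hs0.le)
    rw [hk, le_div_iff₀ hs0] at this
    push_cast at this
    linarith
  have hk2 : r < s * ((k : ℝ) + 2) := by
    have := Nat.lt_floor_add_one (r / s)
    rw [hk, div_lt_iff₀ hs0] at this
    push_cast at this
    linarith
  have hkB : ¬ (((k : ℝ) + 1) ^ (-τ) / 2 ≤ L (k + 3) - L k) := by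
    intro hmem
    refine hrE ?_
    simp only [Set.mem_iUnion]
    exact ⟨k, hmem, hk1, hk2⟩
  rw [not_le] at hkB
  have hk0 : (0 : ℝ) < (k : ℝ) + 1 := by positivity
  set δ : ℝ := ((k : ℝ) + 1) ^ (-τ) / 2 with hδ
  have hδ0 : 0 < δ := by positivity
  have hδ1 : δ ≤ 1 := by
    have : ((k : ℝ) + 1) ^ (-τ) ≤ 1 :=
      Real.rpow_le_one_of_one_le_of_nonpos (by linarith [k.cast_nonneg (α := ℝ)]) (by linarith)
    linarith
  have hexp : Real.exp δ ≤ 1 + 2 * δ := by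
    have := Real.abs_exp_sub_one_le (x := δ) (by rwa [abs_of_pos hδ0])
    rw [abs_of_pos hδ0] at this
    linarith [(abs_le.1 this).2]
  have hratio : H (s * ((k : ℝ) + 3)) ≤ H (s * k) * (1 + 2 * δ) := by
    have h1 : Real.log (H (s * ((k : ℝ) + 3))) ≤ Real.log (H (s * k)) + δ := by
      have := hkB.le
      simp only [hLdef] at this
      push_cast at this
      linarith
    rw [← Real.exp_log (hH0 (s * ((k : ℝ) + 3)))]
    refine (Real.exp_le_exp.2 h1).trans ?_
    rw [Real.exp_add, Real.exp_log (hH0 _)]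
    exact mul_le_mul_of_nonneg_left hexp (hH0 _).le
  have hup : H (r + s) ≤ H (s * ((k : ℝ) + 3)) := hH (by linarith)
  have hlo : H (s * k) ≤ H (r - s) := hH (by linarith)
  have hmid : H (s * k) ≤ H r := hH (by linarith)
  have hδr : 2 * δ ≤ (2 * (s : ℝ)) ^ τ * r ^ (-τ) := by
    have h1 : r / (2 * s) ≤ (k : ℝ) + 1 := by
      rw [div_le_iff₀ (by positivity)]
      nlinarith [k.cast_nonneg (α := ℝ)]
    have h2 := Real.rpow_le_rpow_of_nonpos (by positivity) h1 (by linarith : -τ ≤ 0)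
    rw [Real.div_rpow hr0.le (by positivity), Real.rpow_neg (x := 2 * (s : ℝ)) (by positivity),
      div_inv_eq_mul] at h2
    rw [hδ]
    linarith
  have hrσ : r ^ (-τ) = r ^ (-(τ - σ)) / r ^ σ := by
    rw [← Real.rpow_sub hr0]
    congr 1
    ring
  have hinc : 0 ≤ H (r + s) - H (r - s) := sub_nonneg.2 (hH (by linarith))
  rw [Real.norm_of_nonneg hinc, Real.norm_of_nonneg (div_nonneg (hH0 r).le (by positivity))]
  have hrσ0 : 0 < r ^ σ := by positivity
  calc H (r + s) - H (r - s) ≤ H (s * k) * (2 * δ) := by linarith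
    _ ≤ H r * ((2 * (s : ℝ)) ^ τ * r ^ (-τ)) := mul_le_mul hmid hδr (by positivity) (hH0 r).le
    _ = ((2 * (s : ℝ)) ^ τ * r ^ (-(τ - σ))) * (H r / r ^ σ) := by rw [hrσ]; ring
    _ ≤ c * (H r / r ^ σ) := mul_le_mul_of_nonneg_right hr (div_nonneg (hH0 r).le hrσ0.le)

/-- A function of hyper-order less than `1 - σ` is eventually at most `exp (r ^ ρ)` for some
positive `ρ < 1 - σ`. -/
lemma exists_le_exp_of_hyperOrder {T : ℝ → ℝ} {ρ₂ σ : ℝ} (hρ₂ : hyperOrder T = (ρ₂ : EReal))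
    (hσ : σ < 1 - ρ₂) :
    ∃ ρ, 0 < ρ ∧ σ + ρ < 1 ∧ ∀ᶠ r in atTop, T r ≤ Real.exp (r ^ ρ) := by
  -- `posLog` is nonnegative, hence so is the hyper-order, and `ρ` can be chosen positive.
  have hρ0 : 0 ≤ ρ₂ := by
    have h : (0 : EReal) ≤ hyperOrder T := by
      refine le_limsup_of_frequently_le' (Eventually.frequently ?_)
      filter_upwards [eventually_ge_atTop (1 : ℝ)] with r hr
      exact_mod_cast div_nonneg Real.posLog_nonneg (Real.log_nonneg hr)
    rw [hρ₂] at h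
    exact_mod_cast h
  obtain ⟨ρ, h1, h2⟩ := exists_between (show ρ₂ < 1 - σ by linarith)
  refine ⟨ρ, hρ0.trans_lt h1, by linarith, ?_⟩
  have hlt : hyperOrder T < (ρ : EReal) := by
    rw [hρ₂]
    exact_mod_cast h1
  filter_upwards [eventually_lt_of_limsup_lt hlt, eventually_gt_atTop (1 : ℝ)] with r hr hr1
  have hr' : Real.posLog (Real.posLog (T r)) / Real.log r < ρ := by exact_mod_cast hr
  have hlog := Real.log_pos hr1
  rw [div_lt_iff₀ hlog] at hr'
  have hlogle : ∀ x, Real.log x ≤ Real.posLog x := fun x => by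
    rw [Real.posLog_def]; exact le_max_right _ _
  have hpow : r ^ ρ = Real.exp (ρ * Real.log r) := by
    rw [Real.rpow_def_of_pos (by linarith), mul_comm]
  have h3 : Real.posLog (T r) ≤ r ^ ρ := by
    rcases le_or_gt (Real.posLog (T r)) 0 with h | h
    · exact h.trans (by positivity)
    · rw [hpow, ← Real.exp_log h]
      exact Real.exp_le_exp.2 ((hlogle _).trans hr'.le)
  rcases le_or_gt (T r) 0 with h | h
  · exact h.trans (Real.exp_pos _).le
  · rw [← Real.exp_log h]
    exact Real.exp_le_exp.2 ((hlogle _).trans h3)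

/-! ### Lower bounds for the Cartan characteristic -/

section Curve

variable {n m : ℕ} {F : Fin (m + 1) → ℝ → ℝ}

lemma le_tropMax (F : Fin (m + 1) → ℝ → ℝ) (i : Fin (m + 1)) (x : ℝ) : F i x ≤ tropMax F x :=
  Finset.le_sup' (fun i => F i x) (Finset.mem_univ i)

lemma add_le_two_mul_cartan (F : Fin (m + 1) → ℝ → ℝ) (i l : Fin (m + 1)) (r : ℝ) :
    F i r + F l (-r) - 2 * tropMax F 0 ≤ 2 * cartan F r := by
  rw [cartan]
  linarith [le_tropMax F i r, le_tropMax F l (-r)]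

lemma sum_signedCount_le_cartan (hF : ∀ i, IsPiecewisePoly n (F i)) (i : Fin (m + 1)) {r : ℝ}
    (hr : 0 ≤ r) :
    ∑ k ∈ Finset.Icc 1 n, signedCount (F i) k r ≤ 2 * cartan F r + 2 * (tropMax F 0 - F i 0) := by
  rw [← (hF i).jensen hr]
  linarith [add_le_two_mul_cartan F i i r]

lemma eventually_le_of_two_mul {T : ℝ → ℝ} {c D : ℝ} {k : ℕ} (hk : 1 ≤ k) (hc : 0 < c)
    (h : ∀ᶠ r in atTop, c * r ^ k - D * r ^ (k - 1) ≤ 2 * T r) :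
    ∃ c > 0, ∀ᶠ r : ℝ in atTop, c * r ^ k ≤ T r := by
  refine ⟨c / 4, by positivity, ?_⟩
  filter_upwards [h, eventually_ge_atTop (2 * D / c), eventually_ge_atTop (0 : ℝ)] with r h1 h2 h3
  rw [div_le_iff₀ hc] at h2
  have h4 : r ^ k = r * r ^ (k - 1) := by
    rw [← pow_succ', Nat.sub_add_cancel hk]
  have h5 : 0 ≤ r ^ (k - 1) := pow_nonneg h3 _
  have h6 : 2 * D * r ^ (k - 1) ≤ r * c * r ^ (k - 1) := mul_le_mul_of_nonneg_right h2 h5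
  rw [h4] at h1 ⊢
  linarith

/-- A root of order `j` of a coordinate makes the characteristic grow at least like `r ^ j`. -/
lemma cartan_growth_of_root (hF : ∀ i, IsPiecewisePoly n (F i))
    (hw : ∀ i k, 1 ≤ k → ∀ y, 0 ≤ omegaMult (F i) k y) {i : Fin (m + 1)} {j k : ℕ} {y : ℝ}
    (hk : 1 ≤ k) (hkj : k ≤ j) (hy : omegaMult (F i) j y ≠ 0) :
    ∃ c > 0, ∀ᶠ r : ℝ in atTop, c * r ^ k ≤ cartan F r := by
  have hj : 1 ≤ j := hk.trans hkj
  have hjn : j ≤ n := by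
    by_contra hc
    exact hy ((hF i).omegaMult_of_lt (by omega) y)
  have hpos : 0 < omegaMult (F i) j y := lt_of_le_of_ne (hw i j hj y) hy.symm
  set D := |2 * (tropMax F 0 - F i 0)| with hD
  refine eventually_le_of_two_mul (c := omegaMult (F i) j y * (1 / 2) ^ j) (D := D) hk
    (by positivity) ?_
  filter_upwards [eventually_ge_atTop (1 : ℝ), eventually_ge_atTop (2 * |y|)] with r h1 h2
  have h3 := (hF i).le_signedCount hj (hw i j hj) y r
  have h4 : signedCount (F i) j r ≤ ∑ k ∈ Finset.Icc 1 n, signedCount (F i) k r :=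
    Finset.single_le_sum (f := fun k => signedCount (F i) k r)
      (fun k hk => signedCount_nonneg (hw i k (Finset.mem_Icc.1 hk).1) r)
      (Finset.mem_Icc.2 ⟨hj, hjn⟩)
  have h5 := sum_signedCount_le_cartan hF i (r := r) (by linarith)
  have h6 : (1 / 2) ^ j * r ^ k ≤ max (r - |y|) 0 ^ j := by
    calc (1 / 2 : ℝ) ^ j * r ^ k ≤ (1 / 2) ^ j * r ^ j := by
          gcongr
      _ = (1 / 2 * r) ^ j := (mul_pow _ _ _).symm
      _ ≤ _ := pow_le_pow_left₀ (by positivity) (le_max_of_le_left (by linarith)) j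
  have h7 := mul_le_mul_of_nonneg_left h6 hpos.le
  have h8 : D ≤ D * r ^ (k - 1) := le_mul_of_one_le_right (abs_nonneg _) (one_le_pow₀ h1)
  have h9 := le_abs_self (2 * (tropMax F 0 - F i 0))
  linarith

/-- If `F l` has no root of order at least `k` at the origin, then the part of order at least `k` of
its Taylor polynomials there is an odd function. If `k` is the highest order in which the right
Taylor coefficients of `F i` and `F l` differ, and `F i` has the larger one, then
`F i r + F l (-r)` grows at least like `r ^ k`. -/
lemma cartan_growth_of_coeff_lt (hF : ∀ i, IsPiecewisePoly n (F i))
    (hw : ∀ i k, 1 ≤ k → ∀ y, 0 ≤ omegaMult (F i) k y) {i l : Fin (m + 1)} {k : ℕ}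
    (hk : 1 ≤ k) (hroot : ∀ j, k ≤ j → omegaMult (F l) j 0 = 0)
    (hlt : coeffRight (F l) k 0 < coeffRight (F i) k 0)
    (hgt : ∀ j, k < j → coeffRight (F i) j 0 = coeffRight (F l) j 0) :
    ∃ c > 0, ∀ᶠ r : ℝ in atTop, c * r ^ k ≤ cartan F r := by
  have hkn : k ≤ n := by
    by_contra hc
    rw [(hF i).coeffRight_of_lt (by omega), (hF l).coeffRight_of_lt (by omega)] at hlt
    exact lt_irrefl _ hlt
  set e : ℕ → ℝ := fun j => coeffRight (F i) j 0 + coeffRight (fun t => F l (-t)) j 0 with he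
  have hek : ∀ j, k ≤ j → e j = coeffRight (F i) j 0 - coeffRight (F l) j 0 := fun j hj => by
    have := hroot j hj
    rw [(hF l).omegaMult_zero] at this
    simp only [he]
    linarith
  set D := (∑ j ∈ Finset.Icc 1 n, |e j|) + |F i 0 + F l 0 - 2 * tropMax F 0| with hD
  refine eventually_le_of_two_mul (c := e k) (D := D) hk (by rw [hek k le_rfl]; linarith) ?_
  filter_upwards [eventually_ge_atTop (1 : ℝ)] with r hr
  have hr0 : 0 ≤ r := by linarith
  have h1 := (hF i).taylor_right hr0
  have h2 := (hF l).reflect.taylor_right hr0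
  rw [neg_zero] at h2
  have hR1 : ∑ j ∈ Finset.Icc 1 n, coeffRight (F i) j 0 * r ^ j ≤
      ∑ j ∈ Finset.Icc 1 n, (coeffRight (F i) j 0 * r ^ j + rightCount (F i) j r) :=
    Finset.sum_le_sum fun j hj => le_add_of_nonneg_right
      (rightCount_nonneg (hw i j (Finset.mem_Icc.1 hj).1) r)
  have hR2 : ∑ j ∈ Finset.Icc 1 n, coeffRight (fun t => F l (-t)) j 0 * r ^ j ≤
      ∑ j ∈ Finset.Icc 1 n, (coeffRight (fun t => F l (-t)) j 0 * r ^ j +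
        rightCount (fun t => F l (-t)) j r) :=
    Finset.sum_le_sum fun j hj => le_add_of_nonneg_right
      (rightCount_nonneg (fun y => by
        rw [(hF l).omegaMult_reflect]; exact hw l j (Finset.mem_Icc.1 hj).1 _) r)
  have hterm : ∀ j ∈ Finset.Icc 1 n,
      (if j = k then e k * r ^ k else 0) - |e j| * r ^ (k - 1) ≤ e j * r ^ j := by
    intro j hj
    have hnn : 0 ≤ |e j| * r ^ (k - 1) := by positivity
    rcases lt_trichotomy j k with h | h | h
    · rw [if_neg h.ne, zero_sub]
      have h3 : r ^ j ≤ r ^ (k - 1) := pow_le_pow_right₀ hr (by omega)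
      have h4 : |e j| * r ^ j ≤ |e j| * r ^ (k - 1) :=
        mul_le_mul_of_nonneg_left h3 (abs_nonneg _)
      have h5 : -|e j| * r ^ j ≤ e j * r ^ j :=
        mul_le_mul_of_nonneg_right (neg_abs_le _) (by positivity)
      linarith
    · subst h
      rw [if_pos rfl]
      linarith
    · rw [if_neg h.ne', hek j h.le, hgt j h]
      simp
  have hsum := Finset.sum_le_sum hterm
  rw [Finset.sum_sub_distrib, Finset.sum_ite_eq', if_pos (Finset.mem_Icc.2 ⟨hk, hkn⟩),
    ← Finset.sum_mul] at hsum
  have hsplit : ∑ j ∈ Finset.Icc 1 n, e j * r ^ j =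
      ∑ j ∈ Finset.Icc 1 n, coeffRight (F i) j 0 * r ^ j +
        ∑ j ∈ Finset.Icc 1 n, coeffRight (fun t => F l (-t)) j 0 * r ^ j := by
    rw [← Finset.sum_add_distrib]
    exact Finset.sum_congr rfl fun j _ => by rw [he]; ring
  have h6 := add_le_two_mul_cartan F i l r
  have h7 : |F i 0 + F l 0 - 2 * tropMax F 0| ≤
      |F i 0 + F l 0 - 2 * tropMax F 0| * r ^ (k - 1) :=
    le_mul_of_one_le_right (abs_nonneg _) (one_le_pow₀ hr)
  have h8 := neg_abs_le (F i 0 + F l 0 - 2 * tropMax F 0)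
  rw [hD, add_mul]
  linarith

/-- If the one-sided Taylor coefficients of order `k` at the origin of two coordinates differ, then
the characteristic grows at least like `r ^ k`. -/
lemma cartan_growth_of_coeff_ne (hF : ∀ i, IsPiecewisePoly n (F i))
    (hw : ∀ i k, 1 ≤ k → ∀ y, 0 ≤ omegaMult (F i) k y) {i l : Fin (m + 1)} {k : ℕ} (hk : 1 ≤ k)
    (hne : coeffRight (F i) k 0 ≠ coeffRight (F l) k 0 ∨
      coeffRight (fun t => F i (-t)) k 0 ≠ coeffRight (fun t => F l (-t)) k 0) :
    ∃ c > 0, ∀ᶠ r : ℝ in atTop, c * r ^ k ≤ cartan F r := by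
  classical
  set P : ℕ → Prop := fun j => coeffRight (F i) j 0 ≠ coeffRight (F l) j 0 ∨
      coeffRight (fun t => F i (-t)) j 0 ≠ coeffRight (fun t => F l (-t)) j 0 with hP
  have hPn : ∀ j, P j → j ≤ n := by
    intro j hj
    by_contra hc
    rw [not_le] at hc
    rcases hj with h | h
    · exact h (by rw [(hF i).coeffRight_of_lt hc, (hF l).coeffRight_of_lt hc])
    · exact h (by rw [(hF i).reflect.coeffRight_of_lt hc, (hF l).reflect.coeffRight_of_lt hc])
  -- The highest order in which the coefficients differ.
  set K := Nat.findGreatest P n with hK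
  have hPK : P K := Nat.findGreatest_spec (hPn k hne) hne
  have hkK : k ≤ K := Nat.le_findGreatest (hPn k hne) hne
  have hgt : ∀ j, K < j → ¬ P j := fun j hj hPj =>
    Nat.findGreatest_is_greatest hj (hPn j hPj) hPj
  by_cases hroot : ∃ p : Fin (m + 1), ∃ j, K ≤ j ∧ omegaMult (F p) j 0 ≠ 0
  · obtain ⟨p, j, hj, hp⟩ := hroot
    exact cartan_growth_of_root hF hw hk (hkK.trans hj) hp
  · push Not at hroot
    have hKne : coeffRight (F i) K 0 ≠ coeffRight (F l) K 0 := by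
      rcases hPK with h | h
      · exact h
      · have h1 := hroot i K le_rfl
        have h2 := hroot l K le_rfl
        rw [(hF _).omegaMult_zero] at h1 h2
        exact fun h3 => h (by linarith)
    have hK1 : 1 ≤ K := hk.trans hkK
    have hKgrow : ∃ c > 0, ∀ᶠ r : ℝ in atTop, c * r ^ K ≤ cartan F r := by
      rcases lt_or_gt_of_ne hKne with h | h
      · exact cartan_growth_of_coeff_lt hF hw hK1 (hroot i) h fun j hj => by
          have := hgt j hj
          simp only [hP, not_or, not_not] at this
          exact this.1.symm
      · exact cartan_growth_of_coeff_lt hF hw hK1 (hroot l) h fun j hj => by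
          have := hgt j hj
          simp only [hP, not_or, not_not] at this
          exact this.1
    obtain ⟨c, hc, h⟩ := hKgrow
    refine ⟨c, hc, ?_⟩
    filter_upwards [h, eventually_ge_atTop (1 : ℝ)] with r h1 h2
    exact (mul_le_mul_of_nonneg_left (pow_le_pow_right₀ h2 hkK) hc.le).trans h1

/-! ### Increments of quotients and the Casoratian -/

/-- The increment over `[r - s, r + s]` of all the counting functions of the coordinates. -/
def countIncrement (n s : ℕ) (F : Fin (m + 1) → ℝ → ℝ) (r : ℝ) : ℝ :=
  ∑ i, ∑ k ∈ Finset.Icc 1 n, (signedCount (F i) k (r + s) - signedCount (F i) k (r - s))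

/-- A bound for the increments over `[r - s, r + s]` of the Taylor polynomials at the origin, from
either side, of the quotients of the coordinates by the first one. -/
def taylorIncrement (n s : ℕ) (F : Fin (m + 1) → ℝ → ℝ) (r : ℝ) : ℝ :=
  ∑ i, ∑ k ∈ Finset.Icc 1 n, (|coeffRight (F i) k 0 - coeffRight (F 0) k 0| +
    |coeffRight (fun t => F i (-t)) k 0 - coeffRight (fun t => F 0 (-t)) k 0|) *
      ((r + s) ^ k - (r - s) ^ k)

lemma IsPiecewisePoly.abs_sub_increment_le {f g : ℝ → ℝ} (hf : IsPiecewisePoly n f)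
    (hg : IsPiecewisePoly n g) (hwf : ∀ k, 1 ≤ k → ∀ y, 0 ≤ omegaMult f k y)
    (hwg : ∀ k, 1 ≤ k → ∀ y, 0 ≤ omegaMult g k y) {a b u v : ℝ} (ha : 0 ≤ a) (hau : a ≤ u)
    (hub : u ≤ b) (hav : a ≤ v) (hvb : v ≤ b) :
    (f v - g v) - (f u - g u) ≤ ∑ k ∈ Finset.Icc 1 n,
      (|coeffRight f k 0 - coeffRight g k 0| * (b ^ k - a ^ k) +
        (signedCount f k b - signedCount f k a) + (signedCount g k b - signedCount g k a)) := by
  rw [hf.taylor_right (ha.trans hav), hg.taylor_right (ha.trans hav),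
    hf.taylor_right (ha.trans hau), hg.taylor_right (ha.trans hau)]
  have key : ∀ k ∈ Finset.Icc 1 n,
      (coeffRight f k 0 * v ^ k + rightCount f k v) - (coeffRight g k 0 * v ^ k + rightCount g k v)
        - ((coeffRight f k 0 * u ^ k + rightCount f k u) -
          (coeffRight g k 0 * u ^ k + rightCount g k u)) ≤
      |coeffRight f k 0 - coeffRight g k 0| * (b ^ k - a ^ k) +
        (signedCount f k b - signedCount f k a) + (signedCount g k b - signedCount g k a) := by
    intro k hk
    have hk1 := (Finset.mem_Icc.1 hk).1
    have h1 := (abs_le.1 (hf.abs_rightCount_sub_le hk1 (hwf k hk1) hau hub hav hvb)).2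
    have h2 := (abs_le.1 (hg.abs_rightCount_sub_le hk1 (hwg k hk1) hau hub hav hvb)).1
    have h3 := abs_max_pow_sub_le hau hub hav hvb k
    rw [max_eq_left (ha.trans hav), max_eq_left (ha.trans hau), max_eq_left ha,
      max_eq_left (ha.trans (hau.trans hub))] at h3
    have h4 : (coeffRight f k 0 - coeffRight g k 0) * (v ^ k - u ^ k) ≤
        |coeffRight f k 0 - coeffRight g k 0| * (b ^ k - a ^ k) := by
      refine (le_abs_self _).trans ?_
      rw [abs_mul]
      exact mul_le_mul_of_nonneg_left h3 (abs_nonneg _)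
    linarith
  have := Finset.sum_le_sum key
  rw [Finset.sum_sub_distrib, Finset.sum_sub_distrib, Finset.sum_sub_distrib] at this
  linarith

lemma sum_increment_nonneg (hF : ∀ i, IsPiecewisePoly n (F i))
    (hw : ∀ i k, 1 ≤ k → ∀ y, 0 ≤ omegaMult (F i) k y) (i : Fin (m + 1)) (s : ℕ) (r : ℝ) :
    0 ≤ ∑ k ∈ Finset.Icc 1 n, (signedCount (F i) k (r + s) - signedCount (F i) k (r - s)) := by
  refine Finset.sum_nonneg fun k hk => sub_nonneg.2 ?_
  have hk1 := (Finset.mem_Icc.1 hk).1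
  exact (hF i).signedCount_mono hk1 (hw i k hk1) (by linarith [s.cast_nonneg (α := ℝ)])

lemma sum_increment_le (hF : ∀ i, IsPiecewisePoly n (F i))
    (hw : ∀ i k, 1 ≤ k → ∀ y, 0 ≤ omegaMult (F i) k y) (i : Fin (m + 1)) (s : ℕ) (r : ℝ) :
    ∑ k ∈ Finset.Icc 1 n, (signedCount (F i) k (r + s) - signedCount (F i) k (r - s)) ≤
      countIncrement n s F r :=
  Finset.single_le_sum (f := fun i => ∑ k ∈ Finset.Icc 1 n,
      (signedCount (F i) k (r + s) - signedCount (F i) k (r - s)))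
    (fun i _ => sum_increment_nonneg hF hw i s r) (Finset.mem_univ i)

/-- The increments of the quotient `F i - F 0` near `r` and near `-r`. -/
lemma quotient_increment_le (hF : ∀ i, IsPiecewisePoly n (F i))
    (hw : ∀ i k, 1 ≤ k → ∀ y, 0 ≤ omegaMult (F i) k y) (i : Fin (m + 1)) {s : ℕ} {r u v : ℝ}
    (hr : (s : ℝ) ≤ r) (hu : u ∈ Set.Icc (r - s) (r + s)) (hv : v ∈ Set.Icc (r - s) (r + s)) :
    (F i v - F 0 v) - (F i u - F 0 u) ≤ taylorIncrement n s F r + 2 * countIncrement n s F r ∧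
    (F i (-v) - F 0 (-v)) - (F i (-u) - F 0 (-u)) ≤
      taylorIncrement n s F r + 2 * countIncrement n s F r := by
  have hs0 : (0 : ℝ) ≤ s := s.cast_nonneg
  have hpow : ∀ k, 0 ≤ (r + s) ^ k - (r - s) ^ k := fun k =>
    sub_nonneg.2 (pow_le_pow_left₀ (by linarith) (by linarith) k)
  have hθ : ∑ k ∈ Finset.Icc 1 n, (|coeffRight (F i) k 0 - coeffRight (F 0) k 0| +
      |coeffRight (fun t => F i (-t)) k 0 - coeffRight (fun t => F 0 (-t)) k 0|) *
        ((r + s) ^ k - (r - s) ^ k) ≤ taylorIncrement n s F r :=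
    Finset.single_le_sum (f := fun i => ∑ k ∈ Finset.Icc 1 n,
        (|coeffRight (F i) k 0 - coeffRight (F 0) k 0| +
      |coeffRight (fun t => F i (-t)) k 0 - coeffRight (fun t => F 0 (-t)) k 0|) *
        ((r + s) ^ k - (r - s) ^ k))
      (fun i _ => Finset.sum_nonneg fun k _ => mul_nonneg (by positivity) (hpow k))
      (Finset.mem_univ i)
  have hi := sum_increment_le hF hw i s r
  have h0 := sum_increment_le hF hw 0 s r
  constructor
  · refine ((hF i).abs_sub_increment_le (hF 0) (hw i) (hw 0) (sub_nonneg.2 hr) hu.1 hu.2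
      hv.1 hv.2).trans ?_
    rw [Finset.sum_add_distrib, Finset.sum_add_distrib]
    have : ∑ k ∈ Finset.Icc 1 n, |coeffRight (F i) k 0 - coeffRight (F 0) k 0| *
        ((r + s) ^ k - (r - s) ^ k) ≤ taylorIncrement n s F r :=
      (Finset.sum_le_sum fun k _ => mul_le_mul_of_nonneg_right
        (le_add_of_nonneg_right (abs_nonneg _)) (hpow k)).trans hθ
    linarith
  · refine ((hF i).reflect.abs_sub_increment_le (hF 0).reflect
      (fun k hk y => by rw [(hF i).omegaMult_reflect]; exact hw i k hk _)
      (fun k hk y => by rw [(hF 0).omegaMult_reflect]; exact hw 0 k hk _)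
      (sub_nonneg.2 hr) hu.1 hu.2 hv.1 hv.2).trans ?_
    rw [Finset.sum_add_distrib, Finset.sum_add_distrib]
    simp only [(hF _).signedCount_reflect]
    have : ∑ k ∈ Finset.Icc 1 n,
        |coeffRight (fun t => F i (-t)) k 0 - coeffRight (fun t => F 0 (-t)) k 0| *
        ((r + s) ^ k - (r - s) ^ k) ≤ taylorIncrement n s F r :=
      (Finset.sum_le_sum fun k _ => mul_le_mul_of_nonneg_right
        (le_add_of_nonneg_left (abs_nonneg _)) (hpow k)).trans hθ
    linarith

/-- The tropical quotient of the Casoratian by its diagonal term `∑ i, F_i(x + i)`. -/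
def casoratianDefect (F : Fin (m + 1) → ℝ → ℝ) (x : ℝ) : ℝ :=
  casoratian F x - ∑ i : Fin (m + 1), shift (i : ℕ) (F i) x

lemma casoratianDefect_nonneg (F : Fin (m + 1) → ℝ → ℝ) (x : ℝ) : 0 ≤ casoratianDefect F x := by
  rw [casoratianDefect, sub_nonneg, casoratian]
  exact Finset.le_sup' (fun π : Equiv.Perm (Fin (m + 1)) => ∑ i, shift (π i : ℕ) (F i) x)
    (Finset.mem_univ 1)

/-- The sum `∑ i, F_0(x + π i)` does not depend on `π`, so only the quotients `F i - F 0` enter the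
comparison of the terms of the Casoratian. -/
lemma casoratianDefect_le {x B : ℝ}
    (h : ∀ i a b : Fin (m + 1), (F i (x + (a : ℕ)) - F 0 (x + (a : ℕ))) -
      (F i (x + (b : ℕ)) - F 0 (x + (b : ℕ))) ≤ B) :
    casoratianDefect F x ≤ (m + 1) * B := by
  rw [casoratianDefect, sub_le_iff_le_add, casoratian]
  refine Finset.sup'_le _ _ fun π _ => ?_
  have h0 : ∑ i, F 0 (x + ((π i : Fin (m + 1)) : ℕ)) = ∑ i : Fin (m + 1), F 0 (x + (i : ℕ)) :=
    Equiv.sum_comp π fun i : Fin (m + 1) => F 0 (x + (i : ℕ))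
  have h1 := Finset.sum_le_sum fun i (_ : i ∈ Finset.univ) => h i (π i) i
  simp only [Finset.sum_sub_distrib, Finset.sum_const, Finset.card_univ, Fintype.card_fin,
    nsmul_eq_mul, Nat.cast_add, Nat.cast_one] at h1
  simp only [shift]
  linarith

lemma casoratianDefect_le_increment (hF : ∀ i, IsPiecewisePoly n (F i))
    (hw : ∀ i k, 1 ≤ k → ∀ y, 0 ≤ omegaMult (F i) k y) {r : ℝ} (hr : (m : ℝ) ≤ r) :
    casoratianDefect F r ≤ (m + 1) * (taylorIncrement n m F r + 2 * countIncrement n m F r) ∧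
    casoratianDefect F (-r) ≤
      (m + 1) * (taylorIncrement n m F r + 2 * countIncrement n m F r) := by
  have hb : ∀ a : Fin (m + 1), (0 : ℝ) ≤ (a : ℕ) ∧ ((a : ℕ) : ℝ) ≤ m := fun a =>
    ⟨Nat.cast_nonneg _, by exact_mod_cast Nat.lt_succ_iff.1 a.2⟩
  constructor
  · exact casoratianDefect_le fun i a b => (quotient_increment_le hF hw i hr
      ⟨by linarith [hb b], by linarith [hb b]⟩ ⟨by linarith [hb a], by linarith [hb a]⟩).1
  · refine casoratianDefect_le fun i a b => ?_
    have := (quotient_increment_le hF hw i hr (u := r - (b : ℕ)) (v := r - (a : ℕ))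
      ⟨by linarith [hb b], by linarith [hb b]⟩ ⟨by linarith [hb a], by linarith [hb a]⟩).2
    have e : ∀ a : ℝ, -(r - a) = -r + a := fun a => by ring
    rwa [e, e] at this

lemma isPiecewisePoly_casoratian (hF : ∀ i, IsPiecewisePoly n (F i)) :
    IsPiecewisePoly n (casoratian F) :=
  IsPiecewisePoly.sup' Finset.univ_nonempty fun π _ =>
    IsPiecewisePoly.sum Finset.univ fun i _ => (hF i).shift (π i : ℕ)

/-! ### Comparison of the counting functions -/

lemma IsPiecewisePoly.sum_counting_neg {f : ℝ → ℝ} (hf : IsPiecewisePoly n f) {r : ℝ}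
    (hr : 0 ≤ r) :
    ∑ k ∈ Finset.Icc 1 n, counting k r (-f) =
      ∑ k ∈ Finset.Icc 1 n, counting k r f + (1 / 2) * (f r + f (-r) - 2 * f 0) := by
  rw [hf.jensen hr, Finset.mul_sum, ← Finset.sum_add_distrib]
  exact Finset.sum_congr rfl fun k hk => by
    linarith [hf.counting_neg_sub_counting (Finset.mem_Icc.1 hk).1 r]

lemma sum_Icc_ite_even (n : ℕ) (u : ℕ → ℝ) :
    ∑ k ∈ Finset.Icc 1 n, (if Even k then u k else 0) = ∑ j ∈ Finset.Icc 1 (n / 2), u (2 * j) := by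
  rw [← Finset.sum_filter]
  symm
  refine Finset.sum_nbij (fun j => 2 * j) (fun j hj => ?_) (fun a _ b _ h => by simpa using h)
    (fun k hk => ?_) fun _ _ => rfl
  · simp only [Finset.mem_filter, Finset.mem_Icc] at *
    exact ⟨by omega, even_two_mul j⟩
  · simp only [Finset.coe_filter, Finset.mem_Icc, Set.mem_ofPred_eq, Finset.coe_Icc,
      Set.mem_image, Set.mem_Icc] at *
    obtain ⟨h1, j, hj⟩ := hk
    exact ⟨j, by omega, by omega⟩

lemma sum_abs_counting_sub_counting_shift_le (hF : ∀ i, IsPiecewisePoly n (F i))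
    (hw : ∀ i k, 1 ≤ k → ∀ y, 0 ≤ omegaMult (F i) k y) {r : ℝ} (hr : 2 * (m : ℝ) < r)
    (i : Fin (m + 1)) :
    ∑ k ∈ Finset.Icc 1 n, |counting k r (-F i) - counting k r (-shift (i : ℕ) (F i))| ≤
      ∑ j ∈ Finset.Icc 1 (n / 2),
        |countingOn (Set.Icc (-2 * ((i : ℕ) : ℝ)) 0) (2 * j) r (-shift (i : ℕ) (F i)) -
          countingOn (Set.Icc (-((i : ℕ) : ℝ)) ((i : ℕ) : ℝ)) (2 * j) r (-F i)| +
      ∑ k ∈ Finset.Icc 1 n, (signedCount (F i) k (r + m) - signedCount (F i) k (r - m)) := by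
  have him : ((i : ℕ) : ℝ) ≤ m := by exact_mod_cast Nat.lt_succ_iff.1 i.2
  rw [← sum_Icc_ite_even n fun j =>
    |countingOn (Set.Icc (-2 * ((i : ℕ) : ℝ)) 0) j r (-shift (i : ℕ) (F i)) -
      countingOn (Set.Icc (-((i : ℕ) : ℝ)) ((i : ℕ) : ℝ)) j r (-F i)|, ← Finset.sum_add_distrib]
  refine Finset.sum_le_sum fun k hk => ?_
  have hk1 := (Finset.mem_Icc.1 hk).1
  have hmono := (hF i).signedCount_mono hk1 (hw i k hk1)
  have h1 : signedCount (F i) k (r + (i : ℕ)) ≤ signedCount (F i) k (r + m) := hmono (by linarith)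
  have h2 : signedCount (F i) k (r - m) ≤ signedCount (F i) k (r - (i : ℕ)) := hmono (by linarith)
  have h3 : signedCount (F i) k (r - (i : ℕ)) ≤ signedCount (F i) k (r + (i : ℕ)) :=
    hmono (by linarith [(i : ℕ).cast_nonneg (α := ℝ)])
  split_ifs with he
  · have := (hF i).abs_counting_sub_counting_shift hk1 (hw i k hk1) (i : ℕ) (r := r) (by linarith)
    linarith
  · have := (hF i).abs_counting_sub_counting_shift_of_odd (Nat.not_even_iff_odd.1 he)
      (hw i k hk1) (i : ℕ) r
    linarith

/-- The inequality of the theorem with an explicit error term, valid for all large `r`. -/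
theorem abs_sum_counting_sub_le (hF : ∀ i, IsPiecewisePoly n (F i))
    (hw : ∀ i k, 1 ≤ k → ∀ y, 0 ≤ omegaMult (F i) k y) {r : ℝ} (hr : 2 * (m : ℝ) < r) :
    |∑ i : Fin (m + 1), ∑ j ∈ Finset.Icc 1 n, counting j r (-F i)
        - ∑ j ∈ Finset.Icc 1 n, counting j r (-casoratian F)|
      ≤ ∑ j ∈ Finset.Icc 1 n,
          |counting j r (casoratian F) - ∑ i : Fin (m + 1), counting j r (shift (i : ℕ) (F i))|
        + ∑ i : Fin (m + 1), ∑ j ∈ Finset.Icc 1 (n / 2),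
          |countingOn (Set.Icc (-2 * (i : ℝ)) 0) (2 * j) r (-shift (i : ℕ) (F i))
            - countingOn (Set.Icc (-(i : ℝ)) (i : ℝ)) (2 * j) r (-F i)|
        + ((m + 1) * (taylorIncrement n m F r + 2 * countIncrement n m F r) +
            casoratianDefect F 0 + countIncrement n m F r) := by
  have hm0 : (0 : ℝ) ≤ m := m.cast_nonneg
  have hr0 : 0 ≤ r := by linarith
  have hC := (isPiecewisePoly_casoratian hF).sum_counting_neg hr0
  have hS := Finset.sum_congr (rfl : (Finset.univ : Finset (Fin (m + 1))) = Finset.univ) fun i _ =>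
    ((hF i).shift (i : ℕ)).sum_counting_neg hr0
  rw [Finset.sum_add_distrib, ← Finset.mul_sum, Finset.sum_sub_distrib, Finset.sum_add_distrib,
    ← Finset.mul_sum] at hS
  have hD := casoratianDefect_le_increment hF hw (r := r) (by linarith)
  have hDr := casoratianDefect_nonneg F r
  have hDr' := casoratianDefect_nonneg F (-r)
  have hD0 := casoratianDefect_nonneg F 0
  have hY := Finset.sum_le_sum fun i (_ : i ∈ Finset.univ) =>
    sum_abs_counting_sub_counting_shift_le hF hw hr i
  rw [Finset.sum_add_distrib] at hY
  have hY' : |∑ i : Fin (m + 1), ∑ k ∈ Finset.Icc 1 n,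
      (counting k r (-F i) - counting k r (-shift (i : ℕ) (F i)))| ≤
      ∑ i : Fin (m + 1), ∑ k ∈ Finset.Icc 1 n,
        |counting k r (-F i) - counting k r (-shift (i : ℕ) (F i))| :=
    (Finset.abs_sum_le_sum_abs _ _).trans
      (Finset.sum_le_sum fun i _ => Finset.abs_sum_le_sum_abs _ _)
  have hX := Finset.abs_sum_le_sum_abs (fun j => counting j r (casoratian F) -
    ∑ i : Fin (m + 1), counting j r (shift (i : ℕ) (F i))) (Finset.Icc 1 n)
  rw [Finset.sum_sub_distrib, Finset.sum_comm (s := Finset.Icc 1 n)] at hX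
  simp only [Finset.sum_sub_distrib] at hY'
  simp only [casoratianDefect] at hD hDr hDr' hD0 ⊢
  have hΔ : countIncrement n m F r = ∑ i : Fin (m + 1), ∑ k ∈ Finset.Icc 1 n,
    (signedCount (F i) k (r + m) - signedCount (F i) k (r - m)) := rfl
  rw [← hΔ] at hY
  have hX' := abs_le.1 hX
  have hY'' := abs_le.1 (hY'.trans hY)
  rw [abs_le]
  constructor <;> linarith [hX'.1, hX'.2, hY''.1, hY''.2, hD.1, hD.2]

end Curve

/-! ### The error term -/

section Curve

variable {n m : ℕ} {F : Fin (m + 1) → ℝ → ℝ}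

/-- Either the characteristic grows at least linearly, or no coordinate has a root and all
quotients of coordinates are constant. -/
lemma cartan_growth_or_degenerate (hF : ∀ i, IsPiecewisePoly n (F i))
    (hw : ∀ i k, 1 ≤ k → ∀ y, 0 ≤ omegaMult (F i) k y) :
    (∃ c > 0, ∀ᶠ r : ℝ in atTop, c * r ≤ cartan F r) ∨
      ((∀ i k, 1 ≤ k → ∀ y, omegaMult (F i) k y = 0) ∧
        ∀ i k, 1 ≤ k → coeffRight (F i) k 0 = coeffRight (F 0) k 0 ∧
          coeffRight (fun t => F i (-t)) k 0 = coeffRight (fun t => F 0 (-t)) k 0) := by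
  by_cases h1 : ∃ i k, 1 ≤ k ∧ ∃ y, omegaMult (F i) k y ≠ 0
  · obtain ⟨i, k, hk, y, hy⟩ := h1
    left
    simpa using cartan_growth_of_root hF hw le_rfl hk hy
  by_cases h2 : ∃ i k, 1 ≤ k ∧ (coeffRight (F i) k 0 ≠ coeffRight (F 0) k 0 ∨
      coeffRight (fun t => F i (-t)) k 0 ≠ coeffRight (fun t => F 0 (-t)) k 0)
  · obtain ⟨i, k, hk, hne⟩ := h2
    left
    obtain ⟨c, hc, h⟩ := cartan_growth_of_coeff_ne hF hw hk hne
    refine ⟨c, hc, ?_⟩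
    filter_upwards [h, eventually_ge_atTop (1 : ℝ)] with r hr hr1
    exact (mul_le_mul_of_nonneg_left (le_self_pow₀ hr1 (by omega)) hc.le).trans hr
  · right
    push Not at h1 h2
    exact ⟨h1, h2⟩

/-- In the degenerate case the Casoratian is its diagonal term at the origin, and all increments
vanish. -/
lemma increments_eq_zero_of_degenerate (hF : ∀ i, IsPiecewisePoly n (F i))
    (hroot : ∀ i k, 1 ≤ k → ∀ y, omegaMult (F i) k y = 0)
    (hcoeff : ∀ i k, 1 ≤ k → coeffRight (F i) k 0 = coeffRight (F 0) k 0 ∧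
      coeffRight (fun t => F i (-t)) k 0 = coeffRight (fun t => F 0 (-t)) k 0) (s : ℕ) :
    (∀ r, taylorIncrement n s F r = 0) ∧ (∀ r, countIncrement n s F r = 0) ∧
      casoratianDefect F 0 = 0 := by
  refine ⟨fun r => ?_, fun r => ?_, ?_⟩
  · refine Finset.sum_eq_zero fun i _ => Finset.sum_eq_zero fun k hk => ?_
    obtain ⟨h1, h2⟩ := hcoeff i k (Finset.mem_Icc.1 hk).1
    rw [h1, h2]
    simp
  · refine Finset.sum_eq_zero fun i _ => Finset.sum_eq_zero fun k hk => ?_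
    simp [signedCount, hroot i k (Finset.mem_Icc.1 hk).1]
  · have hconst : ∀ i t, 0 ≤ t → F i t - F 0 t = F i 0 - F 0 0 := by
      intro i t ht
      rw [(hF i).taylor_right ht, (hF 0).taylor_right ht]
      have : ∑ k ∈ Finset.Icc 1 n, (coeffRight (F i) k 0 * t ^ k + rightCount (F i) k t) =
          ∑ k ∈ Finset.Icc 1 n, (coeffRight (F 0) k 0 * t ^ k + rightCount (F 0) k t) := by
        refine Finset.sum_congr rfl fun k hk => ?_
        have hk1 := (Finset.mem_Icc.1 hk).1
        simp [(hcoeff i k hk1).1, rightCount, hroot _ k hk1]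
      rw [this]
      ring
    refine le_antisymm ?_ (casoratianDefect_nonneg F 0)
    have := casoratianDefect_le (F := F) (x := 0) (B := 0) fun i a b => by
      rw [hconst i (0 + (a : ℕ)) (by positivity), hconst i (0 + (b : ℕ)) (by positivity), sub_self]
    simpa using this

/-- A function that is `o(r ^ k / r ^ σ)` is `o(T(r) / r ^ σ)` if `T` grows at least like `r ^ k`. -/
lemma isLittleO_of_growth {T h : ℝ → ℝ} {c σ : ℝ} {k : ℕ} (hc : 0 < c)
    (hT : ∀ᶠ r : ℝ in atTop, c * r ^ k ≤ T r)
    (hh : h =o[atTop] fun r : ℝ => r ^ k / r ^ σ) : h =o[atTop] fun r => T r / r ^ σ := by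
  refine hh.trans_isBigO (IsBigO.of_bound (1 / c) ?_)
  filter_upwards [hT, eventually_gt_atTop (0 : ℝ)] with r h1 h2
  have h3 : 0 < r ^ σ := Real.rpow_pos_of_pos h2 _
  have h4 : 0 < r ^ k := pow_pos h2 k
  have h5 : 0 < T r := lt_of_lt_of_le (by positivity) h1
  rw [Real.norm_of_nonneg (by positivity), Real.norm_of_nonneg (by positivity), ← mul_div_assoc]
  refine div_le_div_of_nonneg_right ?_ h3.le
  rw [one_div, inv_mul_eq_div, le_div_iff₀ hc]
  linarith

/-- Increments of powers over intervals of fixed length. -/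
lemma isLittleO_pow_increment {σ : ℝ} (hσ : σ < 1) (s : ℕ) {k : ℕ} (hk : 1 ≤ k) :
    (fun r : ℝ => (r + s) ^ k - (r - s) ^ k) =o[atTop] fun r : ℝ => r ^ k / r ^ σ := by
  have h1 : (fun r : ℝ => (r + s) ^ k - (r - s) ^ k) =O[atTop] fun r : ℝ => r ^ (k - 1) := by
    refine IsBigO.of_bound (2 * s * k * 2 ^ (k - 1)) ?_
    filter_upwards [eventually_ge_atTop (s : ℝ)] with r hr
    have hs : (0 : ℝ) ≤ s := s.cast_nonneg
    have hr0 : 0 ≤ r := s.cast_nonneg.trans hr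
    have h2 := abs_pow_sub_pow_le (r + (s : ℝ)) (r - s) k
    rw [show r + (s : ℝ) - (r - s) = 2 * s by ring, abs_of_nonneg (by positivity : 0 ≤ 2 * (s : ℝ)),
      abs_of_nonneg (by linarith : 0 ≤ r + (s : ℝ)), abs_of_nonneg (by linarith : 0 ≤ r - (s : ℝ)),
      max_eq_left (by linarith)] at h2
    rw [Real.norm_eq_abs, Real.norm_of_nonneg (by positivity)]
    refine h2.trans ?_
    rw [mul_assoc _ (2 ^ (k - 1)), ← mul_pow]
    exact mul_le_mul_of_nonneg_left
      (pow_le_pow_left₀ (by linarith) (by linarith) _) (by positivity)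
  refine h1.trans_isLittleO ?_
  rw [isLittleO_iff]
  intro c hc
  have hlim : Tendsto (fun r : ℝ => r ^ (-(1 - σ))) atTop (𝓝 0) :=
    tendsto_rpow_neg_atTop (by linarith)
  filter_upwards [hlim.eventually (ge_mem_nhds hc), eventually_gt_atTop (0 : ℝ)] with r h2 h3
  rw [Real.norm_of_nonneg (by positivity), Real.norm_of_nonneg (by positivity)]
  have h4 : r ^ (k - 1) = r ^ (-(1 - σ)) * (r ^ k / r ^ σ) := by
    rw [← Real.rpow_natCast, ← Real.rpow_natCast, ← Real.rpow_sub h3, ← Real.rpow_add h3,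
      Nat.cast_sub hk, Nat.cast_one]
    congr 1
    ring
  rw [h4]
  exact mul_le_mul_of_nonneg_right h2 (by positivity)

lemma isLittleO_taylorIncrement (hF : ∀ i, IsPiecewisePoly n (F i))
    (hw : ∀ i k, 1 ≤ k → ∀ y, 0 ≤ omegaMult (F i) k y) {σ : ℝ} (hσ : σ < 1) (s : ℕ) :
    taylorIncrement n s F =o[atTop] fun r => cartan F r / r ^ σ := by
  refine IsLittleO.fun_sum fun i _ => IsLittleO.fun_sum fun k hk => ?_
  have hk1 := (Finset.mem_Icc.1 hk).1
  by_cases hne : coeffRight (F i) k 0 ≠ coeffRight (F 0) k 0 ∨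
      coeffRight (fun t => F i (-t)) k 0 ≠ coeffRight (fun t => F 0 (-t)) k 0
  · obtain ⟨c, hc, hT⟩ := cartan_growth_of_coeff_ne hF hw hk1 hne
    exact isLittleO_of_growth hc hT ((isLittleO_pow_increment hσ s hk1).const_mul_left _)
  · rw [not_or, not_not, not_not] at hne
    simp [hne.1, hne.2]

lemma isLittleO_const_of_linear_growth {T : ℝ → ℝ} {c σ : ℝ} (hc : 0 < c)
    (hT : ∀ᶠ r : ℝ in atTop, c * r ≤ T r) (hσ : σ < 1) (d : ℝ) :
    (fun _ : ℝ => d) =o[atTop] fun r => T r / r ^ σ := by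
  refine isLittleO_of_growth (k := 1) hc (by simpa using hT) ?_
  have h := (isLittleO_pow_increment hσ 1 (le_refl 1)).const_mul_left (d / 2)
  refine h.congr_left fun r => ?_
  simp only [pow_one, Nat.cast_one]
  ring

/-- If the characteristic grows at least linearly and has hyper-order less than `1 - σ`, then the
increments of the counting functions are `o(T(r) / r ^ σ)` outside a set of finite logarithmic
measure. -/
lemma exists_isLittleO_countIncrement (hF : ∀ i, IsPiecewisePoly n (F i))
    (hw : ∀ i k, 1 ≤ k → ∀ y, 0 ≤ omegaMult (F i) k y) {c ρ σ : ℝ} (hc : 0 < c)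
    (hT : ∀ᶠ r : ℝ in atTop, c * r ≤ cartan F r) (hρ : 0 < ρ) (hσ : 0 < σ) (hσρ : σ + ρ < 1)
    (hTρ : ∀ᶠ r : ℝ in atTop, cartan F r ≤ Real.exp (r ^ ρ)) {s : ℕ} (hs : 1 ≤ s) :
    ∃ E : Set ℝ, FiniteLogMeasure E ∧
      countIncrement n s F =o[atTop ⊓ 𝓟 Eᶜ] fun r => cartan F r / r ^ σ := by
  set H : ℝ → ℝ := fun r =>
    Real.exp 1 + ∑ i, ∑ k ∈ Finset.Icc 1 n, signedCount (F i) k r with hH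
  have hmono : Monotone H := fun a b hab => by
    refine add_le_add le_rfl (Finset.sum_le_sum fun i _ => Finset.sum_le_sum fun k hk => ?_)
    have hk1 := (Finset.mem_Icc.1 hk).1
    exact (hF i).signedCount_mono hk1 (hw i k hk1) hab
  have hHe : ∀ r, Real.exp 1 ≤ H r := fun r =>
    le_add_of_nonneg_right (Finset.sum_nonneg fun i _ => Finset.sum_nonneg fun k hk =>
      signedCount_nonneg (hw i k (Finset.mem_Icc.1 hk).1) r)
  have hHinc : ∀ r, H (r + s) - H (r - s) = countIncrement n s F r := fun r => by
    simp only [hH, countIncrement, Finset.sum_sub_distrib]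
    ring
  set K : ℝ := Real.exp 1 + ∑ i, 2 * (tropMax F 0 - F i 0) with hK
  set A : ℝ := 2 * (m + 1) + 1 with hA
  have hA0 : 0 < A := by positivity
  have hHT : ∀ᶠ r in atTop, H r ≤ A * cartan F r := by
    filter_upwards [hT, eventually_ge_atTop (K / c), eventually_ge_atTop (0 : ℝ)] with r h1 h2 h3
    have h4 := Finset.sum_le_sum fun i (_ : i ∈ Finset.univ) => sum_signedCount_le_cartan hF i h3
    rw [Finset.sum_add_distrib, Finset.sum_const, Finset.card_univ, Fintype.card_fin,
      nsmul_eq_mul] at h4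
    push_cast at h4
    rw [div_le_iff₀ hc] at h2
    simp only [hH, hA]
    linarith
  have hHlog : ∀ᶠ r in atTop, Real.log (H r) ≤ 2 * r ^ ρ := by
    filter_upwards [hHT, hTρ, (tendsto_rpow_atTop hρ).eventually_ge_atTop (Real.log A)]
      with r h1 h2 h3
    have hH0 : 0 < H r := (Real.exp_pos 1).trans_le (hHe r)
    have h4 : H r ≤ A * Real.exp (r ^ ρ) := h1.trans (mul_le_mul_of_nonneg_left h2 hA0.le)
    have h5 := Real.log_le_log hH0 h4
    rw [Real.log_mul hA0.ne' (Real.exp_pos _).ne', Real.log_exp] at h5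
    linarith
  obtain ⟨E, hE, hEo⟩ := exists_isLittleO_increment hmono hHe two_pos hρ hσ hσρ hHlog hs
  refine ⟨E, hE, (hEo.congr_left hHinc).trans_isBigO ?_⟩
  refine IsBigO.mono (IsBigO.of_bound A ?_) inf_le_left
  filter_upwards [hHT, eventually_gt_atTop (0 : ℝ)] with r h1 h2
  have h3 : 0 < r ^ σ := Real.rpow_pos_of_pos h2 _
  have hH0 : 0 < H r := (Real.exp_pos 1).trans_le (hHe r)
  have hT0 : 0 < cartan F r := pos_of_mul_pos_right (hH0.trans_le h1) hA0.le
  rw [Real.norm_of_nonneg (by positivity), Real.norm_of_nonneg (by positivity), ← mul_div_assoc]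
  exact div_le_div_of_nonneg_right h1 h3.le

end Curve

lemma finiteLogMeasure_empty : FiniteLogMeasure ∅ := ⟨MeasurableSet.empty, by simp⟩

end TropNevanlinna

end

open TropNevanlinna

theorem theorem6p2 (n m : ℕ) (hn : 1 ≤ n) (hm : 1 ≤ m)
    (f : ℝ → TropProj m) (F : Fin (m + 1) → ℝ → ℝ)
    (hF : IsReducedRepresentation n f F)
    (hwd : ∃ l : Fin (m + 1), ∀ i : Fin (m + 1), IsWellDefined (F i - F l))
    (ρ₂ : ℝ) (hρ₂ : hyperOrder (cartan F) = (ρ₂ : EReal)) (hρ₂_lt : ρ₂ < 1)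
    (σ : ℝ) (hσ : σ ∈ Set.Ioo 0 (1 - ρ₂)) :
    ∃ E : Set ℝ, FiniteLogMeasure E ∧
      ∃ err : ℝ → ℝ, err =o[atTop ⊓ 𝓟 Eᶜ] (fun r => cartan F r / r ^ σ) ∧
        ∀ᶠ r in atTop ⊓ 𝓟 Eᶜ,
          |∑ i : Fin (m + 1), ∑ j ∈ Finset.Icc 1 n, counting j r (-F i)
              - ∑ j ∈ Finset.Icc 1 n, counting j r (-casoratian F)|
            ≤ ∑ j ∈ Finset.Icc 1 n,
                |counting j r (casoratian F)
                  - ∑ i : Fin (m + 1), counting j r (shift (i : ℕ) (F i))|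
              + ∑ i : Fin (m + 1), ∑ j ∈ Finset.Icc 1 (n / 2),
                |countingOn (Set.Icc (-2 * (i : ℝ)) 0) (2 * j) r (-shift (i : ℕ) (F i))
                  - countingOn (Set.Icc (-(i : ℝ)) (i : ℝ)) (2 * j) r (-F i)|
              + err r := by
  obtain ⟨⟨⟨d, hd, hsup⟩, -⟩, -⟩ := hF
  have hPP : ∀ i, IsPiecewisePoly n (F i) := fun i =>
    (hd i).isPiecewisePoly (hsup ▸ Finset.le_sup (Finset.mem_univ i))
  have hw : ∀ i k, 1 ≤ k → ∀ y, 0 ≤ omegaMult (F i) k y := fun i k hk y =>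
    (hd i).omegaMult_nonneg hk y
  obtain ⟨ρ, hρ, hσρ, hTρ⟩ := exists_le_exp_of_hyperOrder hρ₂ hσ.2
  have hσ1 : σ < 1 := by linarith
  rcases cartan_growth_or_degenerate hPP hw with ⟨c, hc, hT⟩ | ⟨hroot, hcoeff⟩
  · obtain ⟨E, hE, hEo⟩ := exists_isLittleO_countIncrement hPP hw hc hT hρ hσ.1 hσρ hTρ hm
    refine ⟨E, hE, _, ?_, ((eventually_gt_atTop (2 * (m : ℝ))).filter_mono inf_le_left).mono
      fun r hr => abs_sum_counting_sub_le hPP hw hr⟩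
    have h1 := (isLittleO_taylorIncrement hPP hw hσ1 m).mono (inf_le_left (b := 𝓟 Eᶜ))
    have h2 := (isLittleO_const_of_linear_growth hc hT hσ1 (casoratianDefect F 0)).mono
      (inf_le_left (b := 𝓟 Eᶜ))
    exact (((h1.add (hEo.const_mul_left 2)).const_mul_left _).add h2).add hEo
  · obtain ⟨h1, h2, h3⟩ := increments_eq_zero_of_degenerate hPP hroot hcoeff m
    refine ⟨∅, finiteLogMeasure_empty, fun _ => 0, isLittleO_zero _ _,
      ((eventually_gt_atTop (2 * (m : ℝ))).filter_mono inf_le_left).mono fun r hr => ?_⟩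
    simpa [h1, h2, h3] using abs_sum_counting_sub_le hPP hw hr
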